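/- **Setting.** Let $\langle\!\langle\cdot,\cdot\rangle\!\rangle$ be the Minkowski inner product on $\mathbb R^{n+2}_1$, let $\mathcal L^{n+1}$ be the light cone (nonzero null vectors), and identify the conformal sphere $S^n$ with the set $\mathbb P(\mathcal L^{n+1})$ of null lines $\langle v\rangle$, with its quotient topology; the Lorentz group $O(\mathbb R^{n+2}_1)$ acts by $A\langle v\rangle=\langle Av\rangle$. Write $w^*(x)=\langle\!\langle w,x\rangle\!\rangle$ and $(v\wedge w)(x)=\langle\!\langle v,x\rangle\!\rangle w-\langle\!\langle w,x\rangle\!\rangle v$. For a Lie algebra valued $1$-form $\psi$ on $(0,b)$ and $p\in(0,b)$, let $t\mapsto\Gamma_p^{\,t}(\psi)$ be the solution with values in the Lorentz group of $d\Gamma_p(\psi)=\Gamma_p(\psi)\psi$, $\Gamma_p^{\,p}(\psi)=\mathrm{id}$. Let $\varepsilon,b>0$ and let $\langle c\rangle:(-\varepsilon,b)\to S^n$ be a smooth immersion with smooth light cone lift $c$. Let $Q=Q(t)\,dt^2$ be a nowhere zero quadratic differential on $(0,b)$ with a pole of second order at $0$: $t^2Q(t)$ extends smoothly to $(-\varepsilon',b)$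 for some $\varepsilon'>0$, with value $q\neq0$ at $0$. Let $\omega=\frac{Q(t)}{\|c'(t)\|^2}\,c(t)\wedge c'(t)\,dt$, which does not depend on the lift. For $\lambda\in\mathbb R$ and $p\in(0,b)$, the $\lambda$-Calapso transform normalized at $p$ is $\langle c_{\lambda,p}(t)\rangle=\Gamma_p^{\,t}(\lambda\omega)\langle c(t)\rangle$. **Theorem.** Let $\lambda\in\mathbb R$, put $\mu=\lambda q$ and assume $1-2\mu\ge0$. (1) For every $p\in(0,b)$, the Calapso transform $\langle c_{\lambda,p}(t)\rangle$ converges in $S^n$ as $t\to0^+$. (2) The limit is as follows. Let $0<\delta\le\varepsilon$ and let $s:(-\delta,b)\to\mathbb R$ be smooth with $s(0)=0$, $s'>0$ and $Q=q\,ds^2/s^2$ on $(0,b)$. Let $o,\iota$ be null vectors and $\mathfrak t$ a unit vector with $\langle\!\langle o,\iota\rangle\!\rangle=-1$ and $\mathfrak t\perp o,\iota$. Let $F:(-\delta,b)\to O(\mathbb R^{n+2}_1)$ be a smooth frame such that $f=Fo$ is a lift of $\langle c\rangle$ with $f'=s'F\mathfrak t$ and such that, for all constant $x,y\perp o,\iota,\mathfrak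 t$, the normal fields $Fx,Fy$ satisfy $\langle\!\langle (Fx)',F\mathfrak t\rangle\!\rangle=0$ and $\langle\!\langle (Fx)',Fy\rangle\!\rangle=0$. Let $g=FR$ on $(0,b)$, where $R(t)o=s(t)^{-1}o$, $R(t)\iota=s(t)\iota$ and $R(t)=\mathrm{id}$ on $\{o,\iota\}^\perp$, and let $\psi=g^{-1}(\lambda\omega)g+g^{-1}dg$. Put $$v_\pm=\tfrac12\bigl(1\pm\sqrt{1-2\mu}\bigr)^2o+\iota-\bigl(1\pm\sqrt{1-2\mu}\bigr)\mathfrak t ,$$ which are null eigenvectors of $(o-\mathfrak t)\wedge(\iota-\mu\mathfrak t)$ with eigenvalues $\pm\sqrt{1-2\mu}$. Then there is a continuous map $k_\lambda:[0,b)\to\mathcal L^{n+1}$ with $\langle k_\lambda(0)\rangle=\langle v_+\rangle$ such that, for all $p,t\in(0,b)$, $\langle k_\lambda(t)\rangle=\Gamma_t^{\,p}(\psi)\langle k_\lambda(p)\rangle$, and for all $p\in(0,b)$ $$\lim_{t\to0^+}\langle\Gamma_p^{\,t}(\psi)\rangle=\langle k_\lambda(p)v_-^*\rangle\ \text{ in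 }\ \mathbb P\,\mathrm{End}(\mathbb R^{n+2}_1),\qquad \lim_{t\to0^+}\langle c_{\lambda,p}(t)\rangle=g(p)\langle k_\lambda(p)\rangle .$$ For $Q=dt^2/t^2$ one has $q=1$, may take $s(t)=t$, and the condition is $1-2\lambda\ge0$. -/

import Mathlib

open Set Filter Topology
open scoped ContDiff LinearAlgebra.Projectivization

noncomputable section

/-- The quotient topology on a projective space. -/
instance projectivizationTopology (V : Type*) [AddCommGroup V] [Module ℝ V] [TopologicalSpace V] :
    TopologicalSpace (ℙ ℝ V) :=
  TopologicalSpace.coinduced (Projectivization.mk' ℝ) inferInstance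

namespace Moebius

/-! ### Minkowski space, light cone, conformal sphere, Lorentz group -/

/-- The vector space underlying `(n + 2)`-dimensional Minkowski space. -/
abbrev Mink (n : ℕ) : Type := Fin (n + 2) → ℝ

/-- Endomorphisms of Minkowski space (with the operator norm topology). -/
abbrev End (n : ℕ) : Type := Mink n →L[ℝ] Mink n

/-- The Minkowski inner product `- x₀ y₀ + x₁ y₁ + ⋯ + xₙ₊₁ yₙ₊₁`. -/
def mink (n : ℕ) : LinearMap.BilinForm ℝ (Mink n) :=
  LinearMap.mk₂ ℝ (fun x y => -(x 0 * y 0) + ∑ i : Fin (n + 1), x i.succ * y i.succ)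
    (by
      intro x y z
      simp only [Pi.add_apply, add_mul, Finset.sum_add_distrib]
      ring)
    (by
      intro a x y
      simp only [Pi.smul_apply, smul_eq_mul, mul_assoc, ← Finset.mul_sum]
      ring)
    (by
      intro x y z
      simp only [Pi.add_apply, mul_add, Finset.sum_add_distrib]
      ring)
    (by
      intro a x y
      simp only [Pi.smul_apply, smul_eq_mul, mul_left_comm _ a, ← Finset.mul_sum]
      ring)

theorem mink_apply {n : ℕ} (x y : Mink n) :
    mink n x y = -(x 0 * y 0) + ∑ i : Fin (n + 1), x i.succ * y i.succ := rfl

theorem mink_comm {n : ℕ} (x y : Mink n) : mink n x y = mink n y x := by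
  simp only [mink_apply, mul_comm]

theorem mink_nondegenerate {n : ℕ} {w : Mink n} (hw : w ≠ 0) : ∃ x, mink n w x ≠ 0 := by
  by_contra! h
  apply hw
  funext j
  have hj := h (Pi.single j 1)
  rw [mink_apply] at hj
  refine Fin.cases (fun hj => ?_) (fun i hj => ?_) j hj
  · simpa [Pi.single_apply, Fin.succ_ne_zero] using hj
  · simpa [Pi.single_apply, (Fin.succ_ne_zero i).symm] using hj

/-- The light cone: the nonzero null vectors. -/
abbrev LightCone (n : ℕ) : Type := {v : Mink n // v ≠ 0 ∧ mink n v v = 0}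

/-- The conformal `n`-sphere: the projectivization of the light cone, i.e. the set of null lines,
topologized as a subspace of the projective space of Minkowski space. -/
abbrev Sphere (n : ℕ) : Type := {P : ℙ ℝ (Mink n) // ∀ v ∈ P.submodule, mink n v v = 0}

/-- The point `⟨v⟩` of the sphere spanned by a light cone vector `v`. -/
def LightCone.span {n : ℕ} (v : LightCone n) : Sphere n :=
  ⟨Projectivization.mk ℝ (v : Mink n) v.2.1, by
    intro w hw
    rw [Projectivization.submodule_mk, Submodule.mem_span_singleton] at hw
    obtain ⟨a, rfl⟩ := hw
    simp [v.2.2]⟩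

/-- The Lorentz group `O(n + 1, 1)`, as a subgroup of the linear automorphisms. -/
def lorentzGroup (n : ℕ) : Subgroup (Mink n ≃L[ℝ] Mink n) where
  carrier := {A | ∀ x y, mink n (A x) (A y) = mink n x y}
  one_mem' := fun _ _ => rfl
  mul_mem' := by
    intro A B hA hB x y
    exact (hA (B x) (B y)).trans (hB x y)
  inv_mem' := by
    intro A hA x y
    have h := hA (A.symm x) (A.symm y)
    rw [A.apply_symm_apply, A.apply_symm_apply] at h
    exact h.symm

/-- The type of Lorentz transformations. -/
abbrev Lorentz (n : ℕ) : Type := lorentzGroup n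

theorem mem_lorentzGroup {n : ℕ} {A : Mink n ≃L[ℝ] Mink n} :
    A ∈ lorentzGroup n ↔ ∀ x y, mink n (A x) (A y) = mink n x y := Iff.rfl

/-- The linear automorphism underlying a Lorentz transformation. -/
def Lorentz.toEquiv {n : ℕ} (A : Lorentz n) : Mink n ≃L[ℝ] Mink n := A.1

/-- The endomorphism underlying a Lorentz transformation. -/
def Lorentz.toEnd {n : ℕ} (A : Lorentz n) : End n := A.toEquiv

/-- The Möbius transformation of the sphere induced by a Lorentz transformation `A`, that is,
the action of `⟨A⟩ ∈ P O(n + 1, 1)`: `⟨v⟩ ↦ ⟨A v⟩`. -/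
def Lorentz.act {n : ℕ} (A : Lorentz n) (P : Sphere n) : Sphere n :=
  ⟨Projectivization.map A.toEquiv.toLinearEquiv.toLinearMap
      A.toEquiv.injective P.1, by
    obtain ⟨P, hP⟩ := P
    induction P with
    | h v hv =>
      intro w hw
      simp only [Projectivization.map_mk, Projectivization.submodule_mk,
        Submodule.mem_span_singleton] at hw
      obtain ⟨a, rfl⟩ := hw
      have h1 : mink n v v = 0 := hP v (by
        rw [Projectivization.submodule_mk]; exact Submodule.mem_span_singleton_self v)
      have h2 : mink n (A.toEquiv v) (A.toEquiv v) = 0 :=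
        (A.2 v v).trans h1
      simp only [map_smul, LinearMap.smul_apply, smul_eq_mul]
      have h3 : mink n (A.toEquiv.toLinearEquiv.toLinearMap v)
        (A.toEquiv.toLinearEquiv.toLinearMap v) = 0 := h2
      rw [h3]; simp⟩

/-- The class `⟨A⟩` of a Lorentz transformation in the projective space of `End n`. -/
def Lorentz.projEnd {n : ℕ} (A : Lorentz n) : ℙ ℝ (End n) :=
  Projectivization.mk ℝ A.toEnd (by
    intro h
    have h1 : A.toEquiv (Pi.single 0 1) = 0 :=
      DFunLike.congr_fun h (Pi.single 0 1)
    rw [map_eq_zero_iff _ A.toEquiv.injective] at h1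
    simpa using congrFun h1 0)

/-- The endomorphism `v w^*`, i.e. `x ↦ ⟪w, x⟫ v`. -/
def rankOne {n : ℕ} (v w : Mink n) : End n :=
  LinearMap.toContinuousLinearMap ((mink n w).smulRight v)

/-- The class `⟨v w^*⟩` in the projective space of `End n`, for light cone vectors `v`, `w`. -/
def LightCone.projRankOne {n : ℕ} (v w : LightCone n) : ℙ ℝ (End n) :=
  Projectivization.mk ℝ (rankOne (v : Mink n) (w : Mink n)) (by
    intro h
    obtain ⟨x, hx⟩ := mink_nondegenerate w.2.1
    have h1 : mink n (w : Mink n) x • (v : Mink n) = 0 := DFunLike.congr_fun h x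
    exact (smul_ne_zero hx v.2.1) h1)

/-- The element `v ∧ w` of the Lie algebra `o(n + 1, 1)`: `x ↦ ⟪v, x⟫ w - ⟪w, x⟫ v`. -/
def wedge {n : ℕ} (v w : Mink n) : End n := rankOne w v - rankOne v w

/-! ### Polarized curves, primitives, Calapso transforms -/

/-- `c` is a smooth light cone lift over the open interval `I` of a regular curve `⟨c⟩` in the
sphere. (The differential of `⟨c⟩` at `t` is injective iff `c t` and `c' t` are linearly
independent. Every smooth curve over an interval has a smooth lift.) -/
structure IsRegularLift {n : ℕ} (c : ℝ → LightCone n) (I : Set ℝ) : Prop where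
  smooth : ContDiffOn ℝ ∞ (fun t => (c t : Mink n)) I
  immersion : ∀ t ∈ I, LinearIndependent ℝ ![(c t : Mink n), deriv (fun τ => (c τ : Mink n)) t]

/-- The quadratic differential `Q(t) dt²` on `(a, b)` has a pole of order `k` at `a` with leading
coefficient `q`: the function `Q(t) (a - t)^k` extends smoothly to some `(a - ε, b)` with nonzero
value `q` at `a`. -/
def HasPole (Q : ℝ → ℝ) (a b : ℝ) (k : ℕ) (q : ℝ) : Prop :=
  q ≠ 0 ∧ ∃ ε > 0, ∃ h : ℝ → ℝ, ContDiffOn ℝ ∞ h (Ioo (a - ε) b) ∧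
    (∀ t ∈ Ioo a b, h t = Q t * (a - t) ^ k) ∧ h a = q

/-- (The coefficient of `dt` of the orthogonal lift of) the 1-form associated to the polarized
curve `(⟨c⟩, Q)`: it is `𝔔 c ∧ dc` with `𝔔 ‖dc‖² = Q`. It does not depend on the lift `c`. -/
def assocForm {n : ℕ} (c : ℝ → LightCone n) (Q : ℝ → ℝ) (t : ℝ) : End n :=
  let c' : Mink n := deriv (fun τ => (c τ : Mink n)) t
  (Q t / mink n c' c') • wedge (c t : Mink n) c'

/-- `Γ` is the primitive `Γ_p(ψ)` on the open interval `I` of the 1-form `ψ(t) dt` with values in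
the Lorentz Lie algebra: `dΓ = Γ ψ` and `Γ(p) = id`. (`A ↦ ⟨A⟩` induces an isomorphism of Lie
algebras `o(n + 1, 1) → po(n + 1, 1)`, and `⟨Γ⟩` is the primitive in the projective Lorentz group;
it acts on the sphere by `Lorentz.act`.) -/
structure IsPrimitive {n : ℕ} (ψ : ℝ → End n) (I : Set ℝ) (p : ℝ) (Γ : ℝ → Lorentz n) : Prop where
  init : Γ p = 1
  hasDerivAt : ∀ t ∈ I, HasDerivAt (fun τ => (Γ τ).toEnd) ((Γ t).toEnd ∘L ψ t) t

/-- The gauge transform `g⁻¹ ψ g + g⁻¹ g'` of the 1-form `ψ(t) dt`. -/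
def gauge {n : ℕ} (g : ℝ → Lorentz n) (ψ : ℝ → End n) (t : ℝ) : End n :=
  (g t)⁻¹.toEnd ∘L ψ t ∘L (g t).toEnd + (g t)⁻¹.toEnd ∘L deriv (fun τ => (g τ).toEnd) t

/-- The Calapso transform `t ↦ Γ(t) ⟨c(t)⟩`, where `Γ = Γ_p(λ ω)`. -/
def calapso {n : ℕ} (c : ℝ → LightCone n) (Γ : ℝ → Lorentz n) (t : ℝ) : Sphere n :=
  (Γ t).act (c t).span

/-! ### The singular gauge transformation -/

/-- The first three vectors `o, ι, τ` of a pseudo-orthonormal basis of Minkowski space: `o`, `ι`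
are null with `⟪o, ι⟫ = -1` and `τ` is a unit vector orthogonal to both. -/
structure PseudoTriple (n : ℕ) where
  o : Mink n
  ι : Mink n
  τ : Mink n
  o_o : mink n o o = 0
  ι_ι : mink n ι ι = 0
  o_ι : mink n o ι = -1
  τ_τ : mink n τ τ = 1
  o_τ : mink n o τ = 0
  ι_τ : mink n ι τ = 0

namespace PseudoTriple

variable {n : ℕ} (B : PseudoTriple n)

/-- `x ↦ x - (r⁻¹ - 1) ⟪ι, x⟫ o - (r - 1) ⟪o, x⟫ ι`. -/
def boostFun (r : ℝ) : Mink n →ₗ[ℝ] Mink n :=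
  LinearMap.id - (mink n B.ι).smulRight ((r⁻¹ - 1) • B.o) - (mink n B.o).smulRight ((r - 1) • B.ι)

theorem boostFun_apply (r : ℝ) (x : Mink n) : B.boostFun r x =
    x - mink n B.ι x • (r⁻¹ - 1) • B.o - mink n B.o x • (r - 1) • B.ι := rfl

theorem ι_o : mink n B.ι B.o = -1 := (mink_comm _ _).trans B.o_ι

theorem boostFun_inv (r : ℝ) (hr : r ≠ 0) (x : Mink n) :
    B.boostFun r⁻¹ (B.boostFun r x) = x := by
  simp only [boostFun_apply, map_sub, map_smul, B.o_o, B.ι_ι, B.o_ι, B.ι_o]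
  ext i
  simp only [Pi.sub_apply, Pi.smul_apply, smul_eq_mul]
  field_simp
  ring

/-- The Lorentz transformation `R` with `R o = r⁻¹ o`, `R ι = r ι` which is the identity on the
orthogonal complement of `o` and `ι` (for `r ≠ 0`). -/
def boost (r : ℝ) : Lorentz n :=
  if hr : r ≠ 0 then
    ⟨(LinearEquiv.ofLinearMap (B.boostFun r) (B.boostFun r⁻¹)
        (LinearMap.ext fun x => by
          simpa using B.boostFun_inv r⁻¹ (inv_ne_zero hr) x)
        (LinearMap.ext fun x => B.boostFun_inv r hr x)).toContinuousLinearEquiv, mem_lorentzGroup.2 <| by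
      intro x y
      change mink n (B.boostFun r x) (B.boostFun r y) = mink n x y
      simp only [boostFun_apply, map_sub, map_smul, LinearMap.sub_apply, LinearMap.smul_apply,
        B.o_o, B.ι_ι, B.o_ι, B.ι_o, smul_eq_mul, mink_comm x B.o, mink_comm x B.ι]
      field_simp
      ring⟩
  else 1

theorem boost_apply {r : ℝ} (hr : r ≠ 0) (x : Mink n) : (B.boost r).toEnd x = B.boostFun r x := by
  rw [boost, dif_pos hr]
  rfl

theorem boost_o {r : ℝ} (hr : r ≠ 0) : (B.boost r).toEnd B.o = r⁻¹ • B.o := by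
  rw [B.boost_apply hr, boostFun_apply, B.ι_o, B.o_o]
  ext i
  simp
  ring

theorem boost_ι {r : ℝ} (hr : r ≠ 0) : (B.boost r).toEnd B.ι = r • B.ι := by
  rw [B.boost_apply hr, boostFun_apply, B.ι_ι, B.o_ι]
  ext i
  simp
  ring

theorem boost_perp {r : ℝ} (hr : r ≠ 0) {x : Mink n} (h1 : mink n B.o x = 0)
    (h2 : mink n B.ι x = 0) : (B.boost r).toEnd x = x := by
  rw [B.boost_apply hr, boostFun_apply, h1, h2]
  simp

/-- `o` as an element of the light cone. -/
def oL : LightCone n :=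
  ⟨B.o, by
    refine ⟨fun h => ?_, B.o_o⟩
    have := B.o_ι
    simp [h] at this⟩

/-- The null vector `(r² / 2) o + ι - r τ`. -/
def nullVec (r : ℝ) : LightCone n :=
  ⟨(r ^ 2 / 2) • B.o + B.ι - r • B.τ, by
    constructor
    · intro h
      have h1 : mink n B.o ((r ^ 2 / 2) • B.o + B.ι - r • B.τ) = 0 := by rw [h]; simp
      simp [B.o_o, B.o_ι, B.o_τ] at h1
    · simp only [map_sub, map_add, map_smul, LinearMap.sub_apply, LinearMap.add_apply,
        LinearMap.smul_apply, smul_eq_mul, B.o_o, B.ι_ι, B.o_ι, B.ι_o, B.o_τ, B.ι_τ, B.τ_τ,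
        mink_comm B.τ B.o, mink_comm B.τ B.ι]
      ring⟩

/-- The eigenvector of `(o - τ) ∧ (ι - μ τ)` with eigenvalue `√(1 - 2 μ)`. -/
def vPlus (μ : ℝ) : LightCone n := B.nullVec (1 + √(1 - 2 * μ))

/-- The eigenvector of `(o - τ) ∧ (ι - μ τ)` with eigenvalue `-√(1 - 2 μ)`. -/
def vMinus (μ : ℝ) : LightCone n := B.nullVec (1 - √(1 - 2 * μ))

theorem wedge_nullVec (ζ : ℝ) :
    wedge (B.o - B.τ) (B.ι - ((1 - ζ ^ 2) / 2) • B.τ) (B.nullVec (1 + ζ)) =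
      ζ • (B.nullVec (1 + ζ) : Mink n) := by
  simp only [wedge, rankOne, nullVec, _root_.sub_apply,
    LinearMap.coe_toContinuousLinearMap', LinearMap.smulRight_apply, map_sub, map_add, map_smul,
    LinearMap.sub_apply, LinearMap.smul_apply, smul_eq_mul, B.o_o, B.ι_ι, B.o_ι, B.ι_o, B.o_τ,
    B.ι_τ, B.τ_τ, mink_comm B.τ B.o, mink_comm B.τ B.ι]
  ext i
  simp only [Pi.sub_apply, Pi.add_apply, Pi.smul_apply, smul_eq_mul]
  ring

theorem wedge_vPlus {μ : ℝ} (hμ : 0 ≤ 1 - 2 * μ) :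
    wedge (B.o - B.τ) (B.ι - μ • B.τ) (B.vPlus μ) = √(1 - 2 * μ) • (B.vPlus μ : Mink n) := by
  have h := B.wedge_nullVec (√(1 - 2 * μ))
  rwa [Real.sq_sqrt hμ, show (1 - (1 - 2 * μ)) / 2 = μ by ring] at h

theorem wedge_vMinus {μ : ℝ} (hμ : 0 ≤ 1 - 2 * μ) :
    wedge (B.o - B.τ) (B.ι - μ • B.τ) (B.vMinus μ) = (-√(1 - 2 * μ)) • (B.vMinus μ : Mink n) := by
  have h := B.wedge_nullVec (-√(1 - 2 * μ))
  rwa [neg_sq, Real.sq_sqrt hμ, show (1 - (1 - 2 * μ)) / 2 = μ by ring, ← sub_eq_add_neg] at h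

end PseudoTriple

/-- `s` is a parameter on `(-δ, b)` with `s(0) = 0` in which the polarization `Q(t) dt²` on `(0, b)`
with leading coefficient `q` reads `q ds² / s²`. For `Q(t) = 1 / t²` one can take `s(t) = t`. -/
structure IsPolarParameter (Q : ℝ → ℝ) (q δ b : ℝ) (s : ℝ → ℝ) : Prop where
  smooth : ContDiffOn ℝ ∞ s (Ioo (-δ) b)
  zero : s 0 = 0
  deriv_pos : ∀ t ∈ Ioo (-δ) b, 0 < deriv s t
  eq : ∀ t ∈ Ioo 0 b, Q t = q * deriv s t ^ 2 / s t ^ 2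

/-- `F` is a smooth frame along `⟨c⟩` on `I`, mapping the pseudo-orthonormal basis
`o, ι, τ, n₁, …` to `f, f̄, df/ds, N₁, …`, where
* `f = F o` is the lift of `⟨c⟩` with `‖df/ds‖ = 1`, and `F τ = df/ds`;
* the normal fields `N = F x`, for constant `x` orthogonal to `o, ι, τ`, are parallel and satisfy
  `⟪dN, df⟫ = 0`. -/
structure IsFrame {n : ℕ} (B : PseudoTriple n) (c : ℝ → LightCone n) (s : ℝ → ℝ) (I : Set ℝ)
    (F : ℝ → Lorentz n) : Prop where
  smooth : ContDiffOn ℝ ∞ (fun t => (F t).toEnd) I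
  lift : ∀ t ∈ I, (F t).act B.oL.span = (c t).span
  tangent : ∀ t ∈ I, deriv (fun u => (F u).toEnd B.o) t = deriv s t • (F t).toEnd B.τ
  normal_tangent : ∀ t ∈ I, ∀ x : Mink n, mink n B.o x = 0 → mink n B.ι x = 0 → mink n B.τ x = 0 →
    mink n (deriv (fun u => (F u).toEnd x) t) ((F t).toEnd B.τ) = 0
  normal_parallel : ∀ t ∈ I, ∀ x y : Mink n,
    mink n B.o x = 0 → mink n B.ι x = 0 → mink n B.τ x = 0 →
    mink n B.o y = 0 → mink n B.ι y = 0 → mink n B.τ y = 0 →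
    mink n (deriv (fun u => (F u).toEnd x) t) ((F t).toEnd y) = 0

/-- The singular gauge transformation `g = F R`, where `R = R(t)` satisfies `R o = o / s(t)`,
`R ι = s(t) ι` and is the identity on the orthogonal complement of `o, ι`. -/
def singularGauge {n : ℕ} (B : PseudoTriple n) (s : ℝ → ℝ) (F : ℝ → Lorentz n) (t : ℝ) :
    Lorentz n :=
  F t * B.boost (s t)

end Moebius

end

/-!
Put `ζ = √(1 - 2μ)`, `Y = (o - τ) ∧ (ι - μ τ)` and `W = -v₊ v₋*`. The gauge transformation `g`
turns the pole of second order of `λ ω` into a simple pole: `ψ + t⁻¹ Y dt` is bounded at `0`,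
where `Y² = W - ζ Y` and `Y W = ζ W`. In the variable `u = -log t` a primitive `h` of `ψ` solves
`h' = h (Y + R)` with `R = O(exp (-u))`. Grönwall's inequality in a norm adapted to `Y` and `W`
gives `h = O(exp ((ζ + 1/2) u))`. Since `(h W)' = ζ h W + h R W`, it follows that `exp (-ζ u) h W`
converges, to `K = k₀ v₋*` with `k₀` a null vector. Integrating `(h Y)' = h W - ζ h Y + h R Y` and
then `h' = h Y + h R`, by comparison with the iterated primitives of `cosh (ζ u)`, shows that a
multiple of `h` itself converges to `K`, also in the degenerate case `ζ = 0`. As `g o` lifts `⟨c⟩`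
and `⟪v₋, o⟫ = -1 ≠ 0`, the Calapso transform tends to the line of `K o`.

For the first assertion, null rotations provide every curve with a frame to which this applies,
with the scaling function `t`.
-/

noncomputable section

namespace Moebius

section Asymptotics

variable {E : Type*} [NormedAddCommGroup E] [NormedSpace ℝ E] {f f' : ℝ → E} {φ φ' : ℝ → ℝ} {a : ℝ}

theorem norm_sub_le_sub_of_norm_deriv_le (hf : ∀ x ∈ Ici a, HasDerivAt f (f' x) x)
    (hφ : ∀ x ∈ Ici a, HasDerivAt φ (φ' x) x) (h : ∀ x ∈ Ici a, ‖f' x‖ ≤ φ' x) {x y : ℝ}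
    (hx : a ≤ x) (hxy : x ≤ y) : ‖f y - f x‖ ≤ φ y - φ x := by
  have hf' : ∀ z ∈ Icc x y, HasDerivAt (fun z => f z - f x) (f' z) z := fun z hz =>
    (hf z (hx.trans hz.1)).sub_const _
  have hφ' : ∀ z ∈ Icc x y, HasDerivAt (fun z => φ z - φ x) (φ' z) z := fun z hz =>
    (hφ z (hx.trans hz.1)).sub_const _
  exact image_norm_le_of_norm_deriv_right_le_deriv_boundary'
    (fun z hz => (hf' z hz).continuousAt.continuousWithinAt)
    (fun z hz => (hf' z (Ico_subset_Icc_self hz)).hasDerivWithinAt) (by simp)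
    (fun z hz => (hφ' z hz).continuousAt.continuousWithinAt)
    (fun z hz => (hφ' z (Ico_subset_Icc_self hz)).hasDerivWithinAt)
    (fun z hz => h z (hx.trans hz.1)) (right_mem_Icc.2 hxy)

theorem exists_tendsto_of_norm_deriv_le [CompleteSpace E] {l : ℝ}
    (hf : ∀ x ∈ Ici a, HasDerivAt f (f' x) x) (hφ : ∀ x ∈ Ici a, HasDerivAt φ (φ' x) x)
    (h : ∀ x ∈ Ici a, ‖f' x‖ ≤ φ' x) (hl : Tendsto φ atTop (𝓝 l)) :
    ∃ y, Tendsto f atTop (𝓝 y) ∧ ∀ x ∈ Ici a, ‖y - f x‖ ≤ l - φ x := by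
  have hdist : ∀ x ∈ Ici a, ∀ y ∈ Ici a, dist (f x) (f y) ≤ dist (φ x) (φ y) := by
    intro x hx y hy
    wlog hxy : x ≤ y generalizing x y
    · rw [dist_comm, dist_comm (φ x)]
      exact this y hy x hx (le_of_not_ge hxy)
    rw [dist_comm, dist_comm (φ x), dist_eq_norm, Real.dist_eq]
    exact (norm_sub_le_sub_of_norm_deriv_le hf hφ h hx hxy).trans (le_abs_self _)
  have hcauchy : Cauchy (map f atTop) := by
    have hφc := (cauchy_map_iff.1 hl.cauchy_map).2
    rw [tendsto_uniformity_iff_dist_tendsto_zero] at hφc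
    refine cauchy_map_iff.2 ⟨inferInstance, tendsto_uniformity_iff_dist_tendsto_zero.2 ?_⟩
    refine squeeze_zero' (Eventually.of_forall fun _ => dist_nonneg) ?_ hφc
    filter_upwards [prod_mem_prod (Ici_mem_atTop a) (Ici_mem_atTop a)] with p hp
    exact hdist _ hp.1 _ hp.2
  obtain ⟨y, hy⟩ := cauchy_iff_exists_le_nhds.1 hcauchy
  refine ⟨y, hy, fun x hx => ?_⟩
  refine le_of_tendsto_of_tendsto (Tendsto.sub_const hy _).norm (hl.sub_const _) ?_
  filter_upwards [eventually_ge_atTop x] with z hz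
  exact norm_sub_le_sub_of_norm_deriv_le hf hφ h hx hz

theorem isLittleO_of_hasDerivAt_isLittleO (hf : ∀ᶠ x in atTop, HasDerivAt f (f' x) x)
    (hφ : ∀ᶠ x in atTop, HasDerivAt φ (φ' x) x) (hφ' : ∀ᶠ x in atTop, 0 ≤ φ' x)
    (h : f' =o[atTop] φ') (hlim : Tendsto φ atTop atTop) : f =o[atTop] φ := by
  refine Asymptotics.isLittleO_iff.2 fun C hC => ?_
  have hle : ∀ᶠ x in atTop, ‖f' x‖ ≤ C / 2 * φ' x := by
    filter_upwards [Asymptotics.isLittleO_iff.1 h (half_pos hC), hφ'] with x hx h0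
    rwa [Real.norm_of_nonneg h0] at hx
  obtain ⟨a, ha⟩ := eventually_atTop.1 (hf.and (hφ.and hle))
  filter_upwards [eventually_ge_atTop a, hlim.eventually_ge_atTop 0,
    hlim.eventually_ge_atTop ((‖f a‖ - C / 2 * φ a) / (C / 2))] with x hx h0 hbig
  have hmean : ‖f x - f a‖ ≤ C / 2 * φ x - C / 2 * φ a :=
    norm_sub_le_sub_of_norm_deriv_le (fun x hx => (ha x hx).1)
      (fun x hx => (ha x hx).2.1.const_mul (C / 2)) (fun x hx => (ha x hx).2.2) le_rfl hx
  rw [div_le_iff₀ (half_pos hC)] at hbig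
  rw [Real.norm_of_nonneg h0]
  linarith [norm_sub_norm_le (f x) (f a)]

end Asymptotics

section SingularSystem

/-- `S(u) = ∫₀ᵘ cosh(ζ v) dv`, i.e. `sinh (ζ u) / ζ`, or `u` if `ζ = 0`. It governs the growth of
solutions of a linear system whose leading coefficient has the eigenvalues `0, ± ζ`, including the
degenerate case `ζ = 0`. -/
def coshPrimitive (ζ u : ℝ) : ℝ := ∫ v in (0 : ℝ)..u, Real.cosh (ζ * v)

variable {ζ : ℝ}

theorem hasDerivAt_coshPrimitive (ζ u : ℝ) :
    HasDerivAt (coshPrimitive ζ) (Real.cosh (ζ * u)) u :=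
  (Continuous.integral_hasStrictDerivAt (by fun_prop) 0 u).hasDerivAt

theorem continuous_coshPrimitive (ζ : ℝ) : Continuous (coshPrimitive ζ) :=
  continuous_iff_continuousAt.2 fun u => (hasDerivAt_coshPrimitive ζ u).continuousAt

theorem mul_coshPrimitive (ζ u : ℝ) : ζ * coshPrimitive ζ u = Real.sinh (ζ * u) := by
  have hsinh : ∀ v ∈ uIcc 0 (ζ * u), HasDerivAt Real.sinh (Real.cosh v) v := fun v _ =>
    Real.hasDerivAt_sinh v
  rw [coshPrimitive, intervalIntegral.mul_integral_comp_mul_left, mul_zero,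
    intervalIntegral.integral_eq_sub_of_hasDerivAt hsinh
      (Real.continuous_cosh.intervalIntegrable _ _), Real.sinh_zero, sub_zero]

theorem le_coshPrimitive (ζ : ℝ) {u : ℝ} (hu : 0 ≤ u) : u ≤ coshPrimitive ζ u := by
  simpa [coshPrimitive] using intervalIntegral.integral_mono_on (μ := MeasureTheory.volume)
    (f := fun _ => (1 : ℝ)) hu
    intervalIntegrable_const
    (Continuous.intervalIntegrable (by fun_prop) _ _) fun v _ => Real.one_le_cosh (ζ * v)

theorem tendsto_coshPrimitive (ζ : ℝ) : Tendsto (coshPrimitive ζ) atTop atTop :=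
  tendsto_atTop_mono' _ ((eventually_ge_atTop 0).mono fun _ => le_coshPrimitive ζ) tendsto_id

theorem hasDerivAt_exp_mul_coshPrimitive (ζ u : ℝ) :
    HasDerivAt (fun u => Real.exp (ζ * u) * coshPrimitive ζ u)
      (Real.exp (ζ * u) * Real.exp (ζ * u)) u := by
  have hexp : HasDerivAt (fun u => Real.exp (ζ * u)) (Real.exp (ζ * u) * ζ) u := by
    simpa using ((hasDerivAt_id u).const_mul ζ).exp
  refine (hexp.mul (hasDerivAt_coshPrimitive ζ u)).congr_deriv ?_
  rw [mul_assoc, mul_coshPrimitive, ← mul_add, Real.sinh_add_cosh]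

theorem tendsto_exp_mul_coshPrimitive (hζ : 0 ≤ ζ) :
    Tendsto (fun u => Real.exp (ζ * u) * coshPrimitive ζ u) atTop atTop := by
  refine tendsto_atTop_mono' _ ?_ (tendsto_coshPrimitive ζ)
  filter_upwards [eventually_ge_atTop 0] with u hu
  exact le_mul_of_one_le_left (hu.trans (le_coshPrimitive ζ hu))
    (Real.one_le_exp (mul_nonneg hζ hu))

theorem exp_isBigO_coshPrimitive (hζ : 0 ≤ ζ) :
    (fun u => Real.exp (ζ * u)) =O[atTop] coshPrimitive ζ := by
  refine Asymptotics.IsBigO.of_bound (2 * ζ + 1) ?_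
  filter_upwards [eventually_ge_atTop 1] with u hu
  have hS := le_coshPrimitive ζ (zero_le_one.trans hu)
  rw [Real.norm_of_nonneg (Real.exp_pos _).le, Real.norm_of_nonneg (by linarith),
    add_mul, mul_assoc, mul_coshPrimitive, Real.sinh_eq]
  have : Real.exp (-(ζ * u)) ≤ 1 := Real.exp_le_one_iff.2 (by nlinarith)
  linarith

variable {𝔸 : Type*} [NormedRing 𝔸] [NormedAlgebra ℝ 𝔸] {Y W : 𝔸} {R h : ℝ → 𝔸} {a : ℝ}

/-- The map `x ↦ (x, 4 x Y, 16 x W)`. In the sup norm of the triple, the weights make the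
off-diagonal part of right multiplication by `Y` small if `Y * Y = W - ζ • Y`, `Y * W = ζ • W`. -/
def weightedTriple (Y W : 𝔸) : 𝔸 →L[ℝ] 𝔸 × 𝔸 × 𝔸 :=
  (ContinuousLinearMap.id ℝ 𝔸).prod
    (((4 : ℝ) • (ContinuousLinearMap.mul ℝ 𝔸).flip Y).prod
      ((16 : ℝ) • (ContinuousLinearMap.mul ℝ 𝔸).flip W))

theorem weightedTriple_apply (Y W x : 𝔸) :
    weightedTriple Y W x = (x, (4 : ℝ) • (x * Y), (16 : ℝ) • (x * W)) := rfl

theorem norm_le_norm_weightedTriple (Y W x : 𝔸) : ‖x‖ ≤ ‖weightedTriple Y W x‖ :=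
  norm_fst_le (weightedTriple Y W x)

theorem norm_weightedTriple_le (Y W x : 𝔸) :
    ‖weightedTriple Y W x‖ ≤ (1 + 4 * ‖Y‖ + 16 * ‖W‖) * ‖x‖ := by
  have hY : ‖x * Y‖ ≤ ‖Y‖ * ‖x‖ := (norm_mul_le _ _).trans_eq (mul_comm _ _)
  have hW : ‖x * W‖ ≤ ‖W‖ * ‖x‖ := (norm_mul_le _ _).trans_eq (mul_comm _ _)
  have hY0 : 0 ≤ ‖Y‖ * ‖x‖ := by positivity
  have hW0 : 0 ≤ ‖W‖ * ‖x‖ := by positivity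
  have hx0 := norm_nonneg x
  refine norm_prod_le_iff.2 ⟨?_, norm_prod_le_iff.2 ⟨?_, ?_⟩⟩ <;>
  simp only [weightedTriple_apply, norm_smul, Real.norm_ofNat] <;>
  linarith

theorem norm_weightedTriple_mul_le (hζ : 0 ≤ ζ) (hYY : Y * Y = W - ζ • Y)
    (hYW : Y * W = ζ • W) (x : 𝔸) :
    ‖weightedTriple Y W (x * Y)‖ ≤ (ζ + 1 / 4) * ‖weightedTriple Y W x‖ := by
  set N := ‖weightedTriple Y W x‖
  have hxY : 4 * ‖x * Y‖ ≤ N := by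
    rw [← Real.norm_ofNat 4, ← norm_smul]
    exact (norm_fst_le (weightedTriple Y W x).2).trans (norm_snd_le (weightedTriple Y W x))
  have hxW : 16 * ‖x * W‖ ≤ N := by
    rw [← Real.norm_ofNat 16, ← norm_smul]
    exact (norm_snd_le (weightedTriple Y W x).2).trans (norm_snd_le (weightedTriple Y W x))
  have hxYY : ‖x * Y * Y‖ ≤ ‖x * W‖ + ζ * ‖x * Y‖ := by
    rw [mul_assoc, hYY, mul_sub, mul_smul_comm]
    exact (norm_sub_le _ _).trans_eq (by rw [norm_smul, Real.norm_of_nonneg hζ])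
  have hxYW : ‖x * Y * W‖ = ζ * ‖x * W‖ := by
    rw [mul_assoc, hYW, mul_smul_comm, norm_smul, Real.norm_of_nonneg hζ]
  have hζY := mul_le_mul_of_nonneg_left hxY hζ
  have hζW := mul_le_mul_of_nonneg_left hxW hζ
  have hζN : 0 ≤ ζ * N := mul_nonneg hζ (norm_nonneg _)
  have hN0 : 0 ≤ N := norm_nonneg _
  refine norm_prod_le_iff.2 ⟨?_, norm_prod_le_iff.2 ⟨?_, ?_⟩⟩ <;>
  simp only [weightedTriple_apply, norm_smul, Real.norm_ofNat] <;>
  linarith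

theorem norm_le_exp_of_hasDerivAt (hζ : 0 ≤ ζ) (hYY : Y * Y = W - ζ • Y)
    (hYW : Y * W = ζ • W) (hR : ∀ u ∈ Ici a, (1 + 4 * ‖Y‖ + 16 * ‖W‖) * ‖R u‖ ≤ 1 / 4)
    (hh : ∀ u ∈ Ici a, HasDerivAt h (h u * (Y + R u)) u) {u : ℝ} (hu : a ≤ u) :
    ‖h u‖ ≤ (1 + 4 * ‖Y‖ + 16 * ‖W‖) * ‖h a‖ * Real.exp ((ζ + 1 / 2) * (u - a)) := by
  have hderiv : ∀ u ∈ Ici a, HasDerivAt (fun u => weightedTriple Y W (h u))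
      (weightedTriple Y W (h u * (Y + R u))) u := fun u hu =>
    (weightedTriple Y W).hasFDerivAt.comp_hasDerivAt u (hh u hu)
  have hbound : ∀ u ∈ Ici a, ‖weightedTriple Y W (h u * (Y + R u))‖ ≤
      (ζ + 1 / 2) * ‖weightedTriple Y W (h u)‖ := by
    intro u hu
    have hhR : ‖weightedTriple Y W (h u * R u)‖ ≤ 1 / 4 * ‖weightedTriple Y W (h u)‖ :=
      calc _ ≤ (1 + 4 * ‖Y‖ + 16 * ‖W‖) * (‖h u‖ * ‖R u‖) :=
            (norm_weightedTriple_le _ _ _).trans (by gcongr; exact norm_mul_le _ _)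
        _ = ((1 + 4 * ‖Y‖ + 16 * ‖W‖) * ‖R u‖) * ‖h u‖ := by ring
        _ ≤ 1 / 4 * ‖weightedTriple Y W (h u)‖ := by
            gcongr
            exacts [hR u hu, norm_le_norm_weightedTriple _ _ _]
    rw [mul_add, map_add]
    linarith [norm_add_le (weightedTriple Y W (h u * Y)) (weightedTriple Y W (h u * R u)),
      norm_weightedTriple_mul_le hζ hYY hYW (h u)]
  have hgronwall := norm_le_gronwallBound_of_norm_deriv_right_le
    (fun u hu => (hderiv u hu.1).continuousAt.continuousWithinAt)
    (fun u hu => (hderiv u hu.1).hasDerivWithinAt) (norm_weightedTriple_le Y W (h a))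
    (fun u hu => (hbound u hu.1).trans_eq (add_zero _).symm) u ⟨hu, le_rfl⟩
  rw [gronwallBound_ε0] at hgronwall
  exact (norm_le_norm_weightedTriple _ _ _).trans hgronwall

theorem exists_tendsto_exp_smul_mul [CompleteSpace 𝔸] {C N : ℝ} (hN0 : 0 ≤ N)
    (hYW : Y * W = ζ • W) (hR : ∀ u ∈ Ici a, ‖R u‖ ≤ C * Real.exp (-u))
    (hh : ∀ u ∈ Ici a, HasDerivAt h (h u * (Y + R u)) u)
    (hN : ∀ u ∈ Ici a, ‖h u‖ ≤ N * Real.exp ((ζ + 1 / 2) * u)) :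
    ∃ k, Tendsto (fun u => Real.exp (-(ζ * u)) • (h u * W)) atTop (𝓝 k) ∧
      ∀ u ∈ Ici a, ‖k - Real.exp (-(ζ * u)) • (h u * W)‖ ≤
        2 * (N * C * ‖W‖) * Real.exp (-(u / 2)) := by
  have hderiv : ∀ u ∈ Ici a, HasDerivAt (fun u => Real.exp (-(ζ * u)) • (h u * W))
      (Real.exp (-(ζ * u)) • (h u * R u * W)) u := by
    intro u hu
    have hexp : HasDerivAt (fun u => Real.exp (-(ζ * u))) (Real.exp (-(ζ * u)) * -ζ) u := by
      simpa using ((hasDerivAt_id u).const_mul ζ).neg.exp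
    refine (hexp.smul ((hh u hu).mul_const W)).congr_deriv ?_
    rw [mul_add, add_mul, mul_assoc (h u) Y, hYW, mul_smul_comm]
    module
  have hφ : ∀ u ∈ Ici a, HasDerivAt (fun u => -(2 * (N * C * ‖W‖) * Real.exp (-(u / 2))))
      (N * C * ‖W‖ * Real.exp (-(u / 2))) u := fun u _ => by
    have hexp : HasDerivAt (fun u : ℝ => Real.exp (-(u / 2))) (Real.exp (-(u / 2)) * -(1 / 2)) u :=
      ((hasDerivAt_id u).div_const 2).neg.exp
    exact (hexp.const_mul _).neg.congr_deriv (by ring)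
  have hle : ∀ u ∈ Ici a, ‖Real.exp (-(ζ * u)) • (h u * R u * W)‖ ≤
      N * C * ‖W‖ * Real.exp (-(u / 2)) := fun u hu =>
    calc ‖Real.exp (-(ζ * u)) • (h u * R u * W)‖
        ≤ Real.exp (-(ζ * u)) * (‖h u‖ * ‖R u‖ * ‖W‖) := by
          rw [norm_smul, Real.norm_of_nonneg (Real.exp_pos _).le]
          gcongr
          exact norm_mul₃_le
      _ ≤ Real.exp (-(ζ * u)) * (N * Real.exp ((ζ + 1 / 2) * u) * (C * Real.exp (-u)) * ‖W‖) := by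
          gcongr
          exacts [hN u hu, hR u hu]
      _ = N * C * ‖W‖ * (Real.exp (-(ζ * u)) * Real.exp ((ζ + 1 / 2) * u) * Real.exp (-u)) := by
          ring
      _ = N * C * ‖W‖ * Real.exp (-(u / 2)) := by
          rw [← Real.exp_add, ← Real.exp_add]
          ring_nf
  have hlim : Tendsto (fun u => -(2 * (N * C * ‖W‖) * Real.exp (-(u / 2)))) atTop (𝓝 0) := by
    have := (Real.tendsto_exp_neg_atTop_nhds_zero.comp
      (tendsto_id.atTop_div_const (two_pos : (0 : ℝ) < 2))).const_mul (2 * (N * C * ‖W‖))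
    simpa using this.neg
  simpa only [zero_sub, neg_neg] using exists_tendsto_of_norm_deriv_le hderiv hφ hle hlim

variable {H : ℝ → 𝔸ˣ}

theorem exists_growth_bound (hζ : 0 ≤ ζ) (hYY : Y * Y = W - ζ • Y) (hYW : Y * W = ζ • W)
    (hR : R =O[atTop] fun u => Real.exp (-u))
    (hH : ∀ᶠ u in atTop, HasDerivAt (fun v => (H v : 𝔸)) (H u * (Y + R u)) u) :
    ∃ M a : ℝ, 0 ≤ M ∧ ∀ u₁ ∈ Ici a, ∀ u ∈ Ici u₁,
      ‖((H u₁)⁻¹ * H u : 𝔸)‖ ≤ M * Real.exp ((ζ + 1 / 2) * (u - u₁)) := by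
  set M := 1 + 4 * ‖Y‖ + 16 * ‖W‖
  have hMR : Tendsto (fun u => M * ‖R u‖) atTop (𝓝 0) := by
    simpa using (hR.trans_tendsto Real.tendsto_exp_neg_atTop_nhds_zero).norm.const_mul M
  obtain ⟨a, ha⟩ := eventually_atTop.1
    (hH.and (hMR.eventually_le_const (by norm_num : (0 : ℝ) < 1 / 4)))
  refine ⟨M * ‖(1 : 𝔸)‖, a, by positivity, fun u₁ hu₁ u hu => ?_⟩
  rw [← (H u₁).inv_mul]
  refine norm_le_exp_of_hasDerivAt (h := fun u => ((H u₁)⁻¹ * H u : 𝔸)) hζ hYY hYW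
    (fun v hv => (ha v (le_trans hu₁ hv)).2) (fun v hv => ?_) hu
  rw [mul_assoc]
  exact (ha v (le_trans hu₁ hv)).1.const_mul _

-- Dividing by `H u₁` makes the error of the limit small compared with `exp (-ζ u₁)`.
theorem exists_tendsto_normalized [CompleteSpace 𝔸] (hζ : 0 ≤ ζ) (hYY : Y * Y = W - ζ • Y)
    (hYW : Y * W = ζ • W) (hR : R =O[atTop] fun u => Real.exp (-u))
    (hH : ∀ᶠ u in atTop, HasDerivAt (fun v => (H v : 𝔸)) (H u * (Y + R u)) u) :
    ∃ C a : ℝ, ∀ u₁ ∈ Ici a, ∃ k,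
      Tendsto (fun u => Real.exp (-(ζ * u)) • ((H u₁)⁻¹ * H u * W)) atTop (𝓝 k) ∧
        ‖Real.exp (ζ * u₁) • k - W‖ ≤ C * Real.exp (-u₁) := by
  obtain ⟨M, a₁, hM, hgrowth⟩ := exists_growth_bound hζ hYY hYW hR hH
  obtain ⟨C, hC⟩ := hR.bound
  simp only [Real.norm_of_nonneg (Real.exp_pos _).le] at hC
  obtain ⟨a₂, ha₂⟩ := eventually_atTop.1 (hH.and hC)
  refine ⟨2 * (M * C * ‖W‖), max a₁ a₂, fun u₁ hu₁ => ?_⟩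
  have hau₁ : ∀ v ∈ Ici u₁, a₂ ≤ v := fun v hv => (le_max_right _ _).trans (le_trans hu₁ hv)
  have hderiv : ∀ v ∈ Ici u₁, HasDerivAt (fun u => ((H u₁)⁻¹ * H u : 𝔸))
      ((H u₁)⁻¹ * H v * (Y + R v)) v := fun v hv => by
    rw [mul_assoc]
    exact (ha₂ v (hau₁ v hv)).1.const_mul _
  have hnorm : ∀ v ∈ Ici u₁, ‖((H u₁)⁻¹ * H v : 𝔸)‖ ≤
      M * Real.exp (-((ζ + 1 / 2) * u₁)) * Real.exp ((ζ + 1 / 2) * v) := fun v hv => by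
    rw [mul_assoc, ← Real.exp_add, neg_add_eq_sub, ← mul_sub]
    exact hgrowth u₁ (le_trans (le_max_left a₁ a₂) hu₁) v hv
  obtain ⟨k, hk, hrate⟩ := exists_tendsto_exp_smul_mul (by positivity) hYW
    (fun v hv => (ha₂ v (hau₁ v hv)).2) hderiv hnorm
  refine ⟨k, hk, ?_⟩
  have hfactor : Real.exp (ζ * u₁) • k - W = Real.exp (ζ * u₁) •
      (k - Real.exp (-(ζ * u₁)) • (((H u₁)⁻¹ * H u₁ : 𝔸) * W)) := by
    rw [smul_sub, smul_smul, ← Real.exp_add, add_neg_cancel, Real.exp_zero, one_smul,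
      Units.inv_mul, one_mul]
  rw [hfactor, norm_smul, Real.norm_of_nonneg (Real.exp_pos _).le]
  refine (mul_le_mul_of_nonneg_left (hrate u₁ self_mem_Ici) (Real.exp_pos _).le).trans_eq ?_
  have hexp : Real.exp (-u₁) =
      Real.exp (ζ * u₁) * Real.exp (-((ζ + 1 / 2) * u₁)) * Real.exp (-(u₁ / 2)) := by
    rw [← Real.exp_add, ← Real.exp_add]
    ring_nf
  rw [hexp]
  ring

theorem exists_tendsto_dominant [CompleteSpace 𝔸] (hζ : 0 ≤ ζ) (hYY : Y * Y = W - ζ • Y)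
    (hYW : Y * W = ζ • W) (hR : R =O[atTop] fun u => Real.exp (-u))
    (hH : ∀ᶠ u in atTop, HasDerivAt (fun v => (H v : 𝔸)) (H u * (Y + R u)) u) :
    ∃ K, Tendsto (fun u => Real.exp (-(ζ * u)) • (H u * W)) atTop (𝓝 K) ∧
      Tendsto (fun u => Real.exp (ζ * u) • ((H u)⁻¹ * K)) atTop (𝓝 W) := by
  obtain ⟨C, a, hlocal⟩ := exists_tendsto_normalized hζ hYY hYW hR hH
  obtain ⟨k, hk, -⟩ := hlocal a self_mem_Ici
  have hK : Tendsto (fun u => Real.exp (-(ζ * u)) • (H u * W)) atTop (𝓝 (H a * k)) := by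
    simpa [mul_assoc] using hk.const_mul (H a : 𝔸)
  refine ⟨H a * k, hK, ?_⟩
  have hlim : Tendsto (fun u => C * Real.exp (-u)) atTop (𝓝 0) := by
    simpa using Real.tendsto_exp_neg_atTop_nhds_zero.const_mul C
  refine tendsto_iff_norm_sub_tendsto_zero.2 (squeeze_zero' (Eventually.of_forall fun _ =>
    norm_nonneg _) ?_ hlim)
  filter_upwards [eventually_ge_atTop a] with u₁ hu₁
  obtain ⟨k₁, hk₁, hle⟩ := hlocal u₁ hu₁
  have hk₁_eq : k₁ = (H u₁)⁻¹ * (H a * k) :=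
    tendsto_nhds_unique hk₁ (by simpa [mul_assoc] using hK.const_mul ((H u₁)⁻¹ : 𝔸ˣ).val)
  rwa [hk₁_eq] at hle

theorem mul_isLittleO_exp (hζ : 0 ≤ ζ) (hYY : Y * Y = W - ζ • Y)
    (hYW : Y * W = ζ • W) (hR : R =O[atTop] fun u => Real.exp (-u))
    (hH : ∀ᶠ u in atTop, HasDerivAt (fun v => (H v : 𝔸)) (H u * (Y + R u)) u) :
    (fun u => (H u : 𝔸) * R u) =o[atTop] fun u => Real.exp (ζ * u) := by
  obtain ⟨M, a, -, hgrowth⟩ := exists_growth_bound hζ hYY hYW hR hH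
  have hHO : (fun u => (H u : 𝔸)) =O[atTop] fun u => Real.exp ((ζ + 1 / 2) * u) := by
    refine Asymptotics.IsBigO.of_bound
      (‖(H a : 𝔸)‖ * (M * Real.exp (-((ζ + 1 / 2) * a)))) ?_
    filter_upwards [eventually_ge_atTop a] with u hu
    rw [Real.norm_of_nonneg (Real.exp_pos _).le, mul_assoc, mul_assoc, ← Real.exp_add,
      neg_add_eq_sub, ← mul_sub]
    calc ‖(H u : 𝔸)‖ = ‖(H a : 𝔸) * ((H a)⁻¹ * H u)‖ := by rw [Units.mul_inv_cancel_left]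
      _ ≤ _ := (norm_mul_le _ _).trans (by gcongr; exact hgrowth a self_mem_Ici u hu)
  have hexp : (fun u => Real.exp ((ζ + 1 / 2) * u) * Real.exp (-u)) =o[atTop]
      fun u => Real.exp (ζ * u) := by
    simp_rw [← Real.exp_add]
    rw [Real.isLittleO_exp_comp_exp_comp]
    refine (tendsto_id.atTop_div_const (two_pos : (0 : ℝ) < 2)).congr fun u => ?_
    simp only [id]
    ring
  exact (hHO.mul hR).trans_isLittleO hexp

theorem tendsto_inv_smul_iff_isLittleO {E : Type*} [NormedAddCommGroup E] [NormedSpace ℝ E]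
    {l : Filter ℝ} {f : ℝ → E} {K : E} {φ : ℝ → ℝ} (hφ : ∀ᶠ u in l, φ u ≠ 0) :
    Tendsto (fun u => (φ u)⁻¹ • f u) l (𝓝 K) ↔ (fun u => f u - φ u • K) =o[l] φ := by
  rw [← tendsto_sub_nhds_zero_iff, tendsto_zero_iff_norm_tendsto_zero,
    ← Asymptotics.isLittleO_norm_norm, Asymptotics.isLittleO_iff_tendsto'
      (hφ.mono fun u hu h => absurd (norm_eq_zero.1 h) hu)]
  refine tendsto_congr' (hφ.mono fun u hu => ?_)
  beta_reduce
  rw [div_eq_inv_mul, ← norm_inv, ← norm_smul, smul_sub, inv_smul_smul₀ hu]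

theorem mul_sub_coshPrimitive_smul_isLittleO {K : 𝔸} (hζ : 0 ≤ ζ) (hYY : Y * Y = W - ζ • Y)
    (hYW : Y * W = ζ • W) (hR : R =O[atTop] fun u => Real.exp (-u))
    (hH : ∀ᶠ u in atTop, HasDerivAt (fun v => (H v : 𝔸)) (H u * (Y + R u)) u)
    (hK : Tendsto (fun u => Real.exp (-(ζ * u)) • ((H u : 𝔸) * W)) atTop (𝓝 K)) :
    (fun u => (H u : 𝔸) * Y - coshPrimitive ζ u • K) =o[atTop] coshPrimitive ζ := by
  have hHW : (fun u => (H u : 𝔸) * W - Real.exp (ζ * u) • K) =o[atTop]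
      fun u => Real.exp (ζ * u) := by
    refine (tendsto_inv_smul_iff_isLittleO (.of_forall fun u => (Real.exp_pos _).ne')).1 ?_
    simpa only [Real.exp_neg] using hK
  have hrhs : (fun u => Real.exp (ζ * u) •
      ((H u * W - Real.exp (ζ * u) • K) + H u * R u * Y)) =o[atTop]
      fun u => Real.exp (ζ * u) * Real.exp (ζ * u) := by
    have hHRY : (fun u => (H u : 𝔸) * R u * Y) =o[atTop] fun u => Real.exp (ζ * u) := by
      simpa using (mul_isLittleO_exp hζ hYY hYW hR hH).mul_isBigO
        (Asymptotics.isBigO_const_const Y (one_ne_zero (α := ℝ)) atTop)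
    exact (Asymptotics.isBigO_refl (fun u => Real.exp (ζ * u)) atTop).smul_isLittleO (hHW.add hHRY)
  have hderiv : ∀ᶠ u in atTop, HasDerivAt
      (fun u => Real.exp (ζ * u) • ((H u : 𝔸) * Y) - (Real.exp (ζ * u) * coshPrimitive ζ u) • K)
      (Real.exp (ζ * u) • ((H u * W - Real.exp (ζ * u) • K) + H u * R u * Y)) u := by
    filter_upwards [hH] with u hu
    have hexp : HasDerivAt (fun u => Real.exp (ζ * u)) (Real.exp (ζ * u) * ζ) u := by
      simpa using ((hasDerivAt_id u).const_mul ζ).exp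
    refine ((hexp.smul (hu.mul_const Y)).sub
      ((hasDerivAt_exp_mul_coshPrimitive ζ u).smul_const K)).congr_deriv ?_
    rw [mul_add, add_mul, mul_assoc (H u : 𝔸) Y, hYY, mul_sub, mul_smul_comm]
    module
  have hmain := isLittleO_of_hasDerivAt_isLittleO hderiv
    (.of_forall fun u => hasDerivAt_exp_mul_coshPrimitive ζ u)
    (.of_forall fun u => by positivity) hrhs
    (tendsto_exp_mul_coshPrimitive hζ)
  have hinv := (Asymptotics.isBigO_refl (fun u => (Real.exp (ζ * u))⁻¹) atTop).smul_isLittleO hmain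
  refine hinv.congr (fun u => ?_) fun u => ?_
  · rw [smul_sub, inv_smul_smul₀ (Real.exp_pos _).ne', mul_smul,
      inv_smul_smul₀ (Real.exp_pos _).ne']
  · rw [smul_eq_mul, inv_mul_cancel_left₀ (Real.exp_pos _).ne']

theorem exists_tendsto_inv_smul {K : 𝔸} (hζ : 0 ≤ ζ) (hYY : Y * Y = W - ζ • Y)
    (hYW : Y * W = ζ • W) (hR : R =O[atTop] fun u => Real.exp (-u))
    (hH : ∀ᶠ u in atTop, HasDerivAt (fun v => (H v : 𝔸)) (H u * (Y + R u)) u)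
    (hK : Tendsto (fun u => Real.exp (-(ζ * u)) • ((H u : 𝔸) * W)) atTop (𝓝 K)) :
    ∃ φ : ℝ → ℝ, Tendsto φ atTop atTop ∧ Tendsto (fun u => (φ u)⁻¹ • (H u : 𝔸)) atTop (𝓝 K) := by
  set φ : ℝ → ℝ := fun u => ∫ v in (0 : ℝ)..u, coshPrimitive ζ v
  have hφ : ∀ u, HasDerivAt φ (coshPrimitive ζ u) u := fun u =>
    ((continuous_coshPrimitive ζ).integral_hasStrictDerivAt 0 u).hasDerivAt
  have hlim : Tendsto φ atTop atTop := by
    refine tendsto_atTop_mono' atTop ?_ (tendsto_atTop_add_const_right _ (φ 1 - 1) tendsto_id)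
    filter_upwards [eventually_ge_atTop 1] with u hu
    have := norm_sub_le_sub_of_norm_deriv_le (fun x _ => hasDerivAt_id x) (fun x _ => hφ x)
      (fun x (hx : 1 ≤ x) => by simpa using hx.trans (le_coshPrimitive ζ (zero_le_one.trans hx)))
      le_rfl hu
    simp only [id] at this ⊢
    linarith [Real.le_norm_self (u - 1)]
  refine ⟨φ, hlim, (tendsto_inv_smul_iff_isLittleO (hlim.eventually_ne_atTop 0)).2 ?_⟩
  refine isLittleO_of_hasDerivAt_isLittleO
    (f' := fun u => ((H u : 𝔸) * Y - coshPrimitive ζ u • K) + H u * R u) ?_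
    (Eventually.of_forall hφ) ?_ ?_ hlim
  · filter_upwards [hH] with u hu
    exact (hu.sub ((hφ u).smul_const K)).congr_deriv (by rw [mul_add]; abel)
  · filter_upwards [eventually_ge_atTop 0] with u hu
    exact hu.trans (le_coshPrimitive ζ hu)
  · exact (mul_sub_coshPrimitive_smul_isLittleO hζ hYY hYW hR hH hK).add
      ((mul_isLittleO_exp hζ hYY hYW hR hH).trans_isBigO (exp_isBigO_coshPrimitive hζ))

theorem exists_singular_asymptotics [CompleteSpace 𝔸] {G : ℝ → 𝔸ˣ} {ψ : ℝ → 𝔸} (hζ : 0 ≤ ζ)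
    (hYY : Y * Y = W - ζ • Y) (hYW : Y * W = ζ • W)
    (hG : ∀ᶠ t in 𝓝[>] 0, HasDerivAt (fun τ => (G τ : 𝔸)) (G t * ψ t) t)
    (hψ : (fun t => ψ t + t⁻¹ • Y) =O[𝓝[>] 0] fun _ => (1 : ℝ)) :
    ∃ K, Tendsto (fun t => t ^ ζ • (G t * W)) (𝓝[>] 0) (𝓝 K) ∧
      Tendsto (fun t => t ^ (-ζ) • ((G t)⁻¹ * K)) (𝓝[>] 0) (𝓝 W) ∧
      ∃ φ : ℝ → ℝ, Tendsto φ (𝓝[>] 0) atTop ∧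
        Tendsto (fun t => (φ t)⁻¹ • (G t : 𝔸)) (𝓝[>] 0) (𝓝 K) := by
  have hexp : Tendsto (fun u => Real.exp (-u)) atTop (𝓝[>] 0) :=
    Real.tendsto_exp_atBot_nhdsGT.comp tendsto_neg_atTop_atBot
  have hlog : Tendsto (fun t => -Real.log t) (𝓝[>] 0) atTop :=
    tendsto_neg_atBot_atTop.comp Real.tendsto_log_nhdsGT_zero
  set H : ℝ → 𝔸ˣ := fun u => G (Real.exp (-u))
  set R : ℝ → 𝔸 := fun u =>
    -Real.exp (-u) • (ψ (Real.exp (-u)) + (Real.exp (-u))⁻¹ • Y) with hRdef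
  have hR : R =O[atTop] fun u => Real.exp (-u) := by
    exact ((Asymptotics.isBigO_refl (fun u => Real.exp (-u)) atTop).neg_left.smul
      (hψ.comp_tendsto hexp)).congr_right fun _ => mul_one _
  have hH : ∀ᶠ u in atTop, HasDerivAt (fun v => (H v : 𝔸)) (H u * (Y + R u)) u := by
    filter_upwards [hexp.eventually hG] with u hu
    have hexp' : HasDerivAt (fun v => Real.exp (-v)) (-Real.exp (-u)) u := by
      simpa using (hasDerivAt_neg u).exp
    refine (hu.scomp u hexp').congr_deriv ?_
    simp only [H, hRdef]
    rw [← mul_smul_comm, smul_add, smul_smul, neg_mul, mul_inv_cancel₀ (Real.exp_pos _).ne',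
      neg_one_smul, add_neg_cancel_comm_assoc]
  obtain ⟨K, hK, hK'⟩ := exists_tendsto_dominant hζ hYY hYW hR hH
  obtain ⟨φ, hφ, hφK⟩ := exists_tendsto_inv_smul hζ hYY hYW hR hH hK
  have hback : ∀ᶠ t : ℝ in 𝓝[>] 0, H (-Real.log t) = G t ∧
      Real.exp (-(ζ * -Real.log t)) = t ^ ζ ∧ Real.exp (ζ * -Real.log t) = t ^ (-ζ) := by
    filter_upwards [self_mem_nhdsWithin] with t (ht : 0 < t)
    simp only [H, neg_mul, neg_neg, Real.exp_log ht, Real.rpow_def_of_pos ht,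
      mul_comm ζ, mul_neg, and_self]
  refine ⟨K, (hK.comp hlog).congr' ?_, (hK'.comp hlog).congr' ?_, fun t => φ (-Real.log t),
    hφ.comp hlog, (hφK.comp hlog).congr' ?_⟩ <;>
  · filter_upwards [hback] with t ht
    simp only [Function.comp_apply, ht.1, ht.2]

end SingularSystem

section Minkowski

variable {n : ℕ}

theorem rankOne_apply (v w x : Mink n) : rankOne v w x = mink n w x • v := rfl

theorem wedge_apply (v w x : Mink n) : wedge v w x = mink n v x • w - mink n w x • v := rfl

/-- The Minkowski inner product as a continuous bilinear map, for the differential calculus. -/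
def minkL (n : ℕ) : Mink n →L[ℝ] Mink n →L[ℝ] ℝ := (mink n).toContinuousBilinearMap

/-- The wedge product as a continuous bilinear map, for the differential calculus. -/
def wedgeL (n : ℕ) : Mink n →L[ℝ] Mink n →L[ℝ] End n :=
  (LinearMap.mk₂ ℝ wedge
    (fun v v' w => by ext1 x; simp only [wedge_apply, map_add, LinearMap.add_apply,
      _root_.add_apply]; module)
    (fun a v w => by ext1 x; simp only [wedge_apply, map_smul, LinearMap.smul_apply,
      _root_.smul_apply, smul_eq_mul]; module)
    (fun v w w' => by ext1 x; simp only [wedge_apply, map_add, LinearMap.add_apply,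
      _root_.add_apply]; module)
    (fun a v w => by ext1 x; simp only [wedge_apply, map_smul, LinearMap.smul_apply,
      _root_.smul_apply, smul_eq_mul]; module)).toContinuousBilinearMap

theorem wedge_smul (a : ℝ) (v w : Mink n) : wedge v (a • w) = a • wedge v w :=
  map_smul (wedgeL n v) a w

theorem smul_wedge (a : ℝ) (v w : Mink n) : wedge (a • v) w = a • wedge v w :=
  (wedgeL n).map_smul₂ a v w

theorem wedge_add (v w x : Mink n) : wedge v (w + x) = wedge v w + wedge v x :=
  map_add (wedgeL n v) w x

theorem wedge_sub (v w x : Mink n) : wedge v (w - x) = wedge v w - wedge v x :=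
  map_sub (wedgeL n v) w x

theorem sub_wedge (v w x : Mink n) : wedge (v - w) x = wedge v x - wedge w x :=
  (wedgeL n).map_sub₂ v w x

theorem wedge_self (v : Mink n) : wedge v v = 0 := sub_self _

theorem hasDerivAt_mink {f g : ℝ → Mink n} {f' g' : Mink n} {t : ℝ} (hf : HasDerivAt f f' t)
    (hg : HasDerivAt g g' t) :
    HasDerivAt (fun u => mink n (f u) (g u)) (mink n (f t) g' + mink n f' (g t)) t :=
  (((minkL n).hasFDerivAt.comp_hasDerivAt t hf).clm_apply hg).congr_deriv (add_comm _ _)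

theorem continuous_mink : Continuous fun p : Mink n × Mink n => mink n p.1 p.2 :=
  (minkL n).continuous₂

theorem mink_self_nonneg_of_zero {x : Mink n} (h0 : x 0 = 0) : 0 ≤ mink n x x := by
  simpa [mink_apply, h0] using Finset.sum_nonneg fun i _ => mul_self_nonneg (x (Fin.succ i))

theorem eq_zero_of_mink_self_eq_zero {x : Mink n} (h0 : x 0 = 0) (hx : mink n x x = 0) :
    x = 0 := by
  rw [mink_apply, h0, mul_zero, neg_zero, zero_add,
    Finset.sum_eq_zero_iff_of_nonneg fun _ _ => mul_self_nonneg _] at hx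
  exact funext <| Fin.cases h0 fun i => mul_self_eq_zero.1 (hx i (Finset.mem_univ i))

theorem mink_self_pos {c x : Mink n} (hc : mink n c c = 0) (hx : mink n c x = 0)
    (hli : LinearIndependent ℝ ![c, x]) : 0 < mink n x x := by
  have hc0 : c 0 ≠ 0 := fun h => hli.ne_zero 0 (eq_zero_of_mink_self_eq_zero h hc)
  -- Subtracting a multiple of `c` from `x` kills the time component without changing the norm.
  set y := x - (x 0 / c 0) • c with hy
  have hy0 : y 0 = 0 := by simp [hy, hc0]
  have hyx : mink n y y = mink n x x := by
    simp [hy, hc, hx, mink_comm x c]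
  rw [← hyx]
  refine (mink_self_nonneg_of_zero hy0).lt_of_ne' fun h => ?_
  have := LinearIndependent.pair_iff.1 hli (-(x 0 / c 0)) 1 <| by
    rw [one_smul, neg_smul, neg_add_eq_sub, ← hy, eq_zero_of_mink_self_eq_zero hy0 h]
  exact one_ne_zero this.2

theorem LightCone.mink_deriv_eq_zero {c : ℝ → LightCone n} {c' : Mink n} {t : ℝ}
    (hc : HasDerivAt (fun u => (c u : Mink n)) c' t) : mink n (c t : Mink n) c' = 0 := by
  have h : (fun u => mink n (c u : Mink n) (c u)) = fun _ => 0 := funext fun u => (c u).2.2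
  have hcc := hasDerivAt_mink hc hc
  rw [h, mink_comm c'] at hcc
  linarith [hcc.unique (hasDerivAt_const t 0)]

end Minkowski

section LorentzGroup

variable {n : ℕ}

/-- A Lorentz transformation as a unit of the algebra of endomorphisms. -/
def Lorentz.toUnit (A : Lorentz n) : (End n)ˣ := ContinuousLinearEquiv.toUnit A.1

theorem Lorentz.val_inv_toUnit (A : Lorentz n) : ((A.toUnit⁻¹ : (End n)ˣ) : End n) = A⁻¹.toEnd :=
  rfl

theorem Lorentz.toEnd_mul (A B : Lorentz n) : (A * B).toEnd = A.toEnd * B.toEnd := rfl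

theorem Lorentz.toEnd_one : (1 : Lorentz n).toEnd = 1 := rfl

theorem Lorentz.toEnd_mul_inv (A : Lorentz n) : A.toEnd * A⁻¹.toEnd = 1 := by
  rw [← toEnd_mul, mul_inv_cancel, toEnd_one]

theorem Lorentz.toEnd_inv_mul (A : Lorentz n) : A⁻¹.toEnd * A.toEnd = 1 := by
  rw [← toEnd_mul, inv_mul_cancel, toEnd_one]

theorem Lorentz.inv_apply (A : Lorentz n) (x : Mink n) : A⁻¹.toEnd (A.toEnd x) = x :=
  DFunLike.congr_fun A.toEnd_inv_mul x

theorem Lorentz.apply_inv (A : Lorentz n) (x : Mink n) : A.toEnd (A⁻¹.toEnd x) = x :=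
  DFunLike.congr_fun A.toEnd_mul_inv x

theorem Lorentz.mink_toEnd (A : Lorentz n) (x y : Mink n) :
    mink n (A.toEnd x) (A.toEnd y) = mink n x y := A.2 x y

theorem Lorentz.toEnd_ne_zero (A : Lorentz n) {x : Mink n} (hx : x ≠ 0) : A.toEnd x ≠ 0 := fun h =>
  hx (by rw [← A.inv_apply x, h, map_zero])

theorem Lorentz.toEnd_injective : Function.Injective (Lorentz.toEnd (n := n)) := fun _ _ h =>
  Subtype.ext (ContinuousLinearEquiv.coe_injective h)

theorem Lorentz.mink_left (A : Lorentz n) (x y : Mink n) :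
    mink n (A.toEnd x) y = mink n x (A⁻¹.toEnd y) := by
  rw [← A.mink_toEnd x, A.apply_inv]

theorem Lorentz.conj_wedge (A : Lorentz n) (v w : Mink n) :
    A⁻¹.toEnd * wedge v w * A.toEnd = wedge (A⁻¹.toEnd v) (A⁻¹.toEnd w) := by
  ext1 x
  change A⁻¹.toEnd (wedge v w (A.toEnd x)) = _
  rw [wedge_apply, wedge_apply, map_sub, map_smul, map_smul, Lorentz.mink_left, Lorentz.mink_left,
    inv_inv]

theorem mink_skew_of_hasDerivAt {F : ℝ → Lorentz n} {A : End n} {t : ℝ}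
    (hF : HasDerivAt (fun τ => (F τ).toEnd) ((F t).toEnd * A) t) (x y : Mink n) :
    mink n (A x) y = -mink n x (A y) := by
  have h1 : ∀ z : Mink n, HasDerivAt (fun τ => (F τ).toEnd z) ((F t).toEnd (A z)) t := fun z =>
    (hF.clm_apply (hasDerivAt_const t z)).congr_deriv (by simp)
  have h2 := hasDerivAt_mink (h1 x) (h1 y)
  simp only [Lorentz.mink_toEnd] at h2
  have := h2.unique (hasDerivAt_const t _)
  linarith

theorem Lorentz.hasDerivAt_inv {F : ℝ → Lorentz n} {F' : End n} {t : ℝ}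
    (hF : HasDerivAt (fun τ => (F τ).toEnd) F' t) :
    HasDerivAt (fun τ => (F τ)⁻¹.toEnd) (-((F t)⁻¹.toEnd * F' * (F t)⁻¹.toEnd)) t := by
  have h := (hasFDerivAt_ringInverse (𝕜 := ℝ) (F t).toUnit).comp_hasDerivAt t hF
  have he : (fun τ => (F τ)⁻¹.toEnd) = Ring.inverse ∘ fun τ => (F τ).toEnd := by
    funext τ
    exact (Ring.inverse_unit (F τ).toUnit).symm
  rw [he]
  exact h.congr_deriv (by simp [Lorentz.val_inv_toUnit])

theorem mul_inv_eq_of_hasDerivAt {ψ : ℝ → End n} {U : Set ℝ} (hU : IsOpen U)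
    (hUc : IsPreconnected U) {G H : ℝ → Lorentz n}
    (hG : ∀ t ∈ U, HasDerivAt (fun τ => (G τ).toEnd) ((G t).toEnd * ψ t) t)
    (hH : ∀ t ∈ U, HasDerivAt (fun τ => (H τ).toEnd) ((H t).toEnd * ψ t) t)
    {p t : ℝ} (hp : p ∈ U) (ht : t ∈ U) : G t * (H t)⁻¹ = G p * (H p)⁻¹ := by
  have hd : ∀ u ∈ U, HasDerivAt (fun τ => (G τ).toEnd * (H τ)⁻¹.toEnd) 0 u := by
    intro u hu
    refine ((hG u hu).mul (Lorentz.hasDerivAt_inv (hH u hu))).congr_deriv ?_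
    have : (H u)⁻¹.toEnd * ((H u).toEnd * ψ u) * (H u)⁻¹.toEnd = ψ u * (H u)⁻¹.toEnd := by
      rw [← mul_assoc, Lorentz.toEnd_inv_mul, one_mul]
    rw [this, mul_assoc]
    exact (congrArg _ (mul_neg (G u).toEnd (ψ u * (H u)⁻¹.toEnd))).trans (add_neg_cancel _)
  apply Lorentz.toEnd_injective
  exact hU.is_const_of_deriv_eq_zero hUc
    (fun u hu => (hd u hu).differentiableAt.differentiableWithinAt) (fun u hu => (hd u hu).deriv)
    ht hp

/-- A linear isometry of Minkowski space as a Lorentz transformation. -/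
def Lorentz.ofIsometry (T : Mink n →ₗ[ℝ] Mink n) (hT : ∀ x y, mink n (T x) (T y) = mink n x y) :
    Lorentz n :=
  ⟨(LinearEquiv.ofInjectiveEndo T (by
      rw [← LinearMap.ker_eq_bot, LinearMap.ker_eq_bot']
      intro x hx
      by_contra h
      obtain ⟨y, hy⟩ := mink_nondegenerate h
      rw [← hT, hx] at hy
      simp at hy)).toContinuousLinearEquiv, mem_lorentzGroup.2 hT⟩

end LorentzGroup

section Sphere

variable {n : ℕ}

theorem LightCone.span_eq_iff {v w : LightCone n} :
    v.span = w.span ↔ ∃ a : ℝ, a ≠ 0 ∧ (v : Mink n) = a • (w : Mink n) := by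
  rw [LightCone.span, LightCone.span, Subtype.mk.injEq, Projectivization.mk_eq_mk_iff']
  constructor
  · rintro ⟨a, ha⟩
    refine ⟨a, fun h => v.2.1 ?_, ha.symm⟩
    rw [← ha, h, zero_smul]
  · rintro ⟨a, _, ha⟩
    exact ⟨a, ha.symm⟩

/-- The action of a Lorentz transformation on the light cone. -/
def Lorentz.actCone (A : Lorentz n) (v : LightCone n) : LightCone n :=
  ⟨A.toEnd v, A.toEnd_ne_zero v.2.1, by rw [A.mink_toEnd]; exact v.2.2⟩

theorem Lorentz.coe_actCone (A : Lorentz n) (v : LightCone n) :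
    (A.actCone v : Mink n) = A.toEnd v := rfl

theorem Lorentz.act_span (A : Lorentz n) (v : LightCone n) :
    A.act v.span = (A.actCone v).span := rfl

theorem tendsto_mk {V : Type*} [AddCommGroup V] [Module ℝ V] [TopologicalSpace V]
    {α : Type*} {l : Filter α} {f : α → V} {φ : α → ℝ} {v : V} (hv : v ≠ 0) (hf0 : ∀ a, f a ≠ 0)
    (hφ : ∀ᶠ a in l, φ a ≠ 0) (hf : Tendsto (fun a => φ a • f a) l (𝓝 v)) :
    Tendsto (fun a => Projectivization.mk ℝ (f a) (hf0 a)) l (𝓝 (Projectivization.mk ℝ v hv)) := by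
  classical
  obtain ⟨χ, hχ0, hχ⟩ : ∃ χ : α → ℝ, (∀ a, χ a ≠ 0) ∧ ∀ a, φ a ≠ 0 → χ a = φ a := by
    refine ⟨fun a => if φ a = 0 then 1 else φ a, fun a => ?_, fun a ha => if_neg ha⟩
    dsimp only
    split_ifs with h
    · exact one_ne_zero
    · exact h
  have hc : Continuous (Projectivization.mk' ℝ : {v : V // v ≠ 0} → ℙ ℝ V) :=
    continuous_coinduced_rng
  have h : Tendsto (fun a => (⟨χ a • f a, smul_ne_zero (hχ0 a) (hf0 a)⟩ : {v : V // v ≠ 0})) l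
      (𝓝 ⟨v, hv⟩) := by
    refine tendsto_subtype_rng.2 (hf.congr' ?_)
    filter_upwards [hφ] with a ha
    rw [hχ a ha]
  refine ((hc.tendsto _).comp h).congr fun a => ?_
  exact (Projectivization.mk_eq_mk_iff' ℝ _ _ _ _).2 ⟨χ a, rfl⟩

theorem LightCone.tendsto_span {α : Type*} {l : Filter α} {v : α → LightCone n} {φ : α → ℝ}
    {k : LightCone n} (hφ : ∀ᶠ a in l, φ a ≠ 0)
    (h : Tendsto (fun a => φ a • (v a : Mink n)) l (𝓝 k)) :
    Tendsto (fun a => (v a).span) l (𝓝 k.span) :=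
  tendsto_subtype_rng.2 (tendsto_mk k.2.1 (fun a => (v a).2.1) hφ h)

end Sphere

namespace PseudoTriple

variable {n : ℕ} (B : PseudoTriple n)

theorem τ_o : mink n B.τ B.o = 0 := (mink_comm _ _).trans B.o_τ

theorem τ_ι : mink n B.τ B.ι = 0 := (mink_comm _ _).trans B.ι_τ

theorem coe_oL : (B.oL : Mink n) = B.o := rfl

theorem coe_vPlus (μ : ℝ) : (B.vPlus μ : Mink n) =
    ((1 + √(1 - 2 * μ)) ^ 2 / 2) • B.o + B.ι - (1 + √(1 - 2 * μ)) • B.τ := rfl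

theorem coe_vMinus (μ : ℝ) : (B.vMinus μ : Mink n) =
    ((1 - √(1 - 2 * μ)) ^ 2 / 2) • B.o + B.ι - (1 - √(1 - 2 * μ)) • B.τ := rfl

theorem mink_vMinus_o (μ : ℝ) : mink n (B.vMinus μ) B.o = -1 := by
  simp [coe_vMinus, B.o_o, B.ι_o, B.τ_o]

/-- The endomorphism `(o - τ) ∧ (ι - μ τ)`: up to sign, the residue at `0` of the gauge transformed
connection form `ψ`. -/
def residue (μ : ℝ) : End n := wedge (B.o - B.τ) (B.ι - μ • B.τ)

theorem residue_eq (μ : ℝ) :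
    B.residue μ = wedge B.o B.ι - μ • wedge B.o B.τ - wedge B.τ B.ι := by
  rw [residue, sub_wedge, wedge_sub, wedge_sub, wedge_smul, wedge_smul, wedge_self, smul_zero,
    sub_zero]

theorem residue_mul_self {μ : ℝ} (hμ : 0 ≤ 1 - 2 * μ) : B.residue μ * B.residue μ =
    -rankOne (B.vPlus μ : Mink n) (B.vMinus μ) - √(1 - 2 * μ) • B.residue μ := by
  obtain ⟨ζ, hζ⟩ : ∃ ζ, √(1 - 2 * μ) = ζ := ⟨_, rfl⟩
  have hμζ : μ = (1 - ζ ^ 2) / 2 := by rw [← hζ, Real.sq_sqrt hμ]; ring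
  ext1 x
  change B.residue μ (B.residue μ x) = -(rankOne _ _ x) - √(1 - 2 * μ) • B.residue μ x
  rw [coe_vPlus, coe_vMinus, hζ, hμζ]
  simp only [residue, wedge_apply, rankOne_apply, map_sub, map_add, map_smul, LinearMap.sub_apply,
    LinearMap.add_apply, LinearMap.smul_apply, smul_eq_mul, B.o_o, B.ι_ι, B.o_ι, B.ι_o, B.o_τ,
    B.ι_τ, B.τ_τ, B.τ_o, B.τ_ι]
  module

theorem residue_mul_rankOne {μ : ℝ} (hμ : 0 ≤ 1 - 2 * μ) (w : Mink n) :
    B.residue μ * rankOne (B.vPlus μ : Mink n) w =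
      √(1 - 2 * μ) • rankOne (B.vPlus μ : Mink n) w := by
  ext1 x
  change B.residue μ (mink n w x • (B.vPlus μ : Mink n)) = √(1 - 2 * μ) • mink n w x • _
  rw [map_smul, residue, B.wedge_vPlus hμ, smul_comm]

theorem toEnd_boost {r : ℝ} (hr : r ≠ 0) : (B.boost r).toEnd =
    1 - (r⁻¹ - 1) • rankOne B.o B.ι - (r - 1) • rankOne B.ι B.o := by
  ext1 x
  rw [B.boost_apply hr, boostFun_apply]
  change _ = x - (r⁻¹ - 1) • (mink n B.ι x • B.o) - (r - 1) • (mink n B.o x • B.ι)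
  module

theorem boost_inv {r : ℝ} (hr : r ≠ 0) : (B.boost r)⁻¹ = B.boost r⁻¹ := by
  rw [inv_eq_iff_mul_eq_one]
  apply Lorentz.toEnd_injective
  ext1 x
  change (B.boost r).toEnd ((B.boost r⁻¹).toEnd x) = x
  rw [B.boost_apply hr, B.boost_apply (inv_ne_zero hr)]
  simpa using B.boostFun_inv r⁻¹ (inv_ne_zero hr) x

theorem hasDerivAt_boost {r : ℝ → ℝ} {r' t : ℝ} (hr : HasDerivAt r r' t) (h0 : r t ≠ 0) :
    HasDerivAt (fun u => (B.boost (r u)).toEnd)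
      ((B.boost (r t)).toEnd * (-(r' / r t) • wedge B.o B.ι)) t := by
  have h1 : HasDerivAt (fun u => 1 - ((r u)⁻¹ - 1) • rankOne B.o B.ι - (r u - 1) • rankOne B.ι B.o)
      (-(-r' / r t ^ 2) • rankOne B.o B.ι - r' • rankOne B.ι B.o) t :=
    (((((hr.inv h0).sub_const 1).smul_const (rankOne B.o B.ι)).const_sub 1).sub
      ((hr.sub_const 1).smul_const (rankOne B.ι B.o))).congr_deriv (by module)
  refine (h1.congr_of_eventuallyEq ?_).congr_deriv ?_
  · filter_upwards [hr.continuousAt.eventually_ne h0] with u hu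
    exact B.toEnd_boost hu
  · ext1 x
    change -(-r' / r t ^ 2) • (mink n B.ι x • B.o) - r' • (mink n B.o x • B.ι) =
      (B.boost (r t)).toEnd (-(r' / r t) • (wedge B.o B.ι x))
    rw [wedge_apply, map_smul, map_sub, map_smul, map_smul, B.boost_o h0, B.boost_ι h0, smul_sub,
      smul_smul, smul_smul, smul_smul, smul_smul, smul_smul, smul_smul]
    have e1 : -(r' / r t) * mink n B.o x * r t = -(r' * mink n B.o x) := by field_simp
    have e2 : -(r' / r t) * mink n B.ι x * (r t)⁻¹ = -r' / r t ^ 2 * mink n B.ι x := by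
      field_simp
    rw [e1, e2]
    module

end PseudoTriple

section AssocForm

variable {n : ℕ}

theorem hasDerivAt_mul_apply {F : ℝ → Lorentz n} {A : End n} {t : ℝ}
    (hF : HasDerivAt (fun τ => (F τ).toEnd) ((F t).toEnd * A) t) (x : Mink n) :
    HasDerivAt (fun τ => (F τ).toEnd x) ((F t).toEnd (A x)) t :=
  (hF.clm_apply (hasDerivAt_const t x)).congr_deriv (by simp)

variable {c f : ℝ → LightCone n} {t : ℝ}

theorem exists_eventuallyEq_smul (hc : DifferentiableAt ℝ (fun u => (c u : Mink n)) t)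
    (hf : DifferentiableAt ℝ (fun u => (f u : Mink n)) t)
    (h : ∀ᶠ u in 𝓝 t, (f u).span = (c u).span) :
    ∃ κ : ℝ → ℝ, DifferentiableAt ℝ κ t ∧
      (fun u => (f u : Mink n)) =ᶠ[𝓝 t] fun u => κ u • (c u : Mink n) := by
  obtain ⟨e, he⟩ := mink_nondegenerate (c t).2.1
  have hce := hasDerivAt_mink hc.hasDerivAt (hasDerivAt_const t e)
  have hfe := hasDerivAt_mink hf.hasDerivAt (hasDerivAt_const t e)
  refine ⟨fun u => mink n (f u) e / mink n (c u) e, (hfe.div hce he).differentiableAt, ?_⟩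
  filter_upwards [h, hce.continuousAt.eventually_ne he] with u hu hne
  obtain ⟨a, -, ha⟩ := LightCone.span_eq_iff.1 hu
  rw [ha, map_smul, LinearMap.smul_apply, smul_eq_mul, mul_div_cancel_right₀ _ hne]

theorem assocForm_eq_of_span_eq (Q : ℝ → ℝ)
    (hc : DifferentiableAt ℝ (fun u => (c u : Mink n)) t)
    (hf : DifferentiableAt ℝ (fun u => (f u : Mink n)) t)
    (h : ∀ᶠ u in 𝓝 t, (f u).span = (c u).span) : assocForm f Q t = assocForm c Q t := by
  obtain ⟨κ, hκ, hfκ⟩ := exists_eventuallyEq_smul hc hf h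
  set c' := deriv (fun u => (c u : Mink n)) t
  have hft : (f t : Mink n) = κ t • (c t : Mink n) := hfκ.self_of_nhds
  have hκ0 : κ t ≠ 0 := fun h0 => (f t).2.1 (by rw [hft, h0, zero_smul])
  have hf' : deriv (fun u => (f u : Mink n)) t = κ t • c' + deriv κ t • (c t : Mink n) := by
    exact hfκ.deriv_eq.trans (hκ.hasDerivAt.smul hc.hasDerivAt).deriv
  have hcc : mink n (c t : Mink n) c' = 0 := LightCone.mink_deriv_eq_zero hc.hasDerivAt
  have hnorm : mink n (κ t • c' + deriv κ t • (c t : Mink n))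
      (κ t • c' + deriv κ t • (c t : Mink n)) = κ t ^ 2 * mink n c' c' := by
    simp only [map_add, map_smul, LinearMap.add_apply, LinearMap.smul_apply, smul_eq_mul, hcc,
      mink_comm c' (c t), (c t).2.2]
    ring
  have hwedge : wedge (κ t • (c t : Mink n)) (κ t • c' + deriv κ t • (c t : Mink n)) =
      κ t ^ 2 • wedge (c t : Mink n) c' := by
    rw [wedge_add, wedge_smul, wedge_smul, smul_wedge, smul_wedge, wedge_self, smul_smul, ← sq,
      smul_zero, smul_zero, add_zero]
  simp only [assocForm]
  rw [hf', hnorm, hft, hwedge, smul_smul, div_mul_eq_mul_div, mul_comm (Q t),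
    mul_div_mul_left _ _ (pow_ne_zero 2 hκ0)]

theorem gauge_assocForm {g : ℝ → Lorentz n} {M : End n} {v : LightCone n} (Q : ℝ → ℝ) (lam : ℝ)
    (hg : HasDerivAt (fun τ => (g τ).toEnd) ((g t).toEnd * M) t)
    (hlift : ∀ᶠ u in 𝓝 t, (g u).act v.span = (c u).span)
    (hc : DifferentiableAt ℝ (fun u => (c u : Mink n)) t) :
    gauge g (fun u => lam • assocForm c Q u) t =
      lam • (Q t / mink n (M v) (M v)) • wedge (v : Mink n) (M v) + M := by
  have hgv := hasDerivAt_mul_apply hg v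
  have hω : assocForm c Q t =
      (Q t / mink n (M v) (M v)) • wedge ((g t).toEnd v) ((g t).toEnd (M v)) := by
    rw [← assocForm_eq_of_span_eq (f := fun u => (g u).actCone v) Q hc hgv.differentiableAt hlift]
    simp only [assocForm, Lorentz.coe_actCone, hgv.deriv, Lorentz.mink_toEnd]
  calc gauge g (fun u => lam • assocForm c Q u) t
      = (g t)⁻¹.toEnd * (lam • assocForm c Q t) * (g t).toEnd +
          (g t)⁻¹.toEnd * deriv (fun τ => (g τ).toEnd) t := rfl
    _ = _ := by
      rw [hg.deriv, ← mul_assoc, Lorentz.toEnd_inv_mul, one_mul, hω, mul_smul_comm, mul_smul_comm,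
        smul_mul_assoc, smul_mul_assoc, Lorentz.conj_wedge, Lorentz.inv_apply, Lorentz.inv_apply]

theorem hasDerivAt_mul_gauge {Γ g : ℝ → Lorentz n} {ψ : ℝ → End n} {t : ℝ}
    (hΓ : HasDerivAt (fun τ => (Γ τ).toEnd) ((Γ t).toEnd * ψ t) t)
    (hg : DifferentiableAt ℝ (fun τ => (g τ).toEnd) t) :
    HasDerivAt (fun τ => (Γ τ * g τ).toEnd) ((Γ t * g t).toEnd * gauge g ψ t) t := by
  have hcancel (M : End n) : (Γ t * g t).toEnd * ((g t)⁻¹.toEnd * M) = (Γ t).toEnd * M := by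
    rw [Lorentz.toEnd_mul, mul_assoc, ← mul_assoc (g t).toEnd, Lorentz.toEnd_mul_inv, one_mul]
  have hgauge : gauge g ψ t = (g t)⁻¹.toEnd * (ψ t * (g t).toEnd) +
    (g t)⁻¹.toEnd * deriv (fun τ => (g τ).toEnd) t := rfl
  refine (hΓ.mul hg.hasDerivAt).congr_deriv ?_
  rw [hgauge, mul_add, hcancel, hcancel, ← mul_assoc]

end AssocForm

section SingularGauge

variable {n : ℕ} {B : PseudoTriple n}

theorem hasDerivAt_singularGauge {F : ℝ → Lorentz n} {A : End n} {t r' : ℝ}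
    {r : ℝ → ℝ} (hF : HasDerivAt (fun τ => (F τ).toEnd) ((F t).toEnd * A) t)
    (hr : HasDerivAt r r' t) (hr0 : r t ≠ 0) :
    HasDerivAt (fun τ => (singularGauge B r F τ).toEnd) ((singularGauge B r F t).toEnd *
      ((B.boost (r t))⁻¹.toEnd * A * (B.boost (r t)).toEnd - (r' / r t) • wedge B.o B.ι)) t := by
  have hcancel : (singularGauge B r F t).toEnd *
      ((B.boost (r t))⁻¹.toEnd * A * (B.boost (r t)).toEnd) =
        (F t).toEnd * A * (B.boost (r t)).toEnd := by
    rw [singularGauge, Lorentz.toEnd_mul, mul_assoc, ← mul_assoc _ _ (B.boost (r t)).toEnd,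
      ← mul_assoc (B.boost (r t)).toEnd, Lorentz.toEnd_mul_inv, one_mul, ← mul_assoc]
  refine (hF.mul (B.hasDerivAt_boost hr hr0)).congr_deriv ?_
  rw [sub_eq_add_neg, ← neg_smul (r' / r t) (wedge B.o B.ι), mul_add, hcancel, singularGauge,
    Lorentz.toEnd_mul, mul_assoc _ _ (-(r' / r t) • _)]

theorem singularGauge_act_oL {F : ℝ → Lorentz n} {r : ℝ → ℝ} {t : ℝ} (hr0 : r t ≠ 0) :
    (singularGauge B r F t).act B.oL.span = (F t).act B.oL.span := by
  rw [Lorentz.act_span, Lorentz.act_span, LightCone.span_eq_iff]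
  refine ⟨(r t)⁻¹, inv_ne_zero hr0, ?_⟩
  change (F t).toEnd ((B.boost (r t)).toEnd B.o) = (r t)⁻¹ • (F t).toEnd B.o
  rw [B.boost_o hr0, map_smul]

/-- Only the component `A o ∧ ι` of `A` is scaled by `r⁻¹`, all else stays bounded as `r → 0`. -/
theorem boost_conj {A : End n} {r : ℝ} (hr0 : r ≠ 0)
    (hA : ∀ x y, mink n (A x) y = -mink n x (A y)) (hι : mink n B.ι (A B.o) = 0) :
    (B.boost r)⁻¹.toEnd * A * (B.boost r).toEnd = wedge (r⁻¹ • A B.o) B.ι +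
      (1 - (r - 1) • rankOne B.o B.ι) * (A - wedge (A B.o) B.ι) *
        (1 - (r - 1) • rankOne B.ι B.o) := by
  have hself (x : Mink n) : mink n x (A x) = 0 := by linarith [hA x x, mink_comm x (A x)]
  have hoι : mink n B.o (A B.ι) = 0 := by rw [mink_comm, hA, hι, neg_zero]
  ext1 x
  have hox : mink n B.o (A x) = -mink n (A B.o) x := by rw [hA, neg_neg]
  rw [B.boost_inv hr0]
  change (B.boost r⁻¹).toEnd (A ((B.boost r).toEnd x)) =
    (wedge (r⁻¹ • A B.o) B.ι) x + (fun y => y - (r - 1) • rankOne B.o B.ι y)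
      ((fun y => A y - wedge (A B.o) B.ι y) (x - (r - 1) • rankOne B.ι B.o x))
  rw [B.boost_apply (inv_ne_zero hr0), B.boost_apply hr0]
  simp only [PseudoTriple.boostFun_apply, wedge_apply, rankOne_apply, map_sub, map_smul,
    LinearMap.smul_apply, smul_eq_mul, hself, hoι, hox, hι, B.ι_ι, mink_comm (A B.o) B.ι, inv_inv]
  match_scalars <;> field_simp <;> ring

theorem boost_conj_apply_o {A : End n} {r : ℝ} (hr0 : r ≠ 0) (ho : mink n B.o (A B.o) = 0)
    (hι : mink n B.ι (A B.o) = 0) :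
    ((B.boost r)⁻¹.toEnd * A * (B.boost r).toEnd) B.o = r⁻¹ • A B.o := by
  change (B.boost r)⁻¹.toEnd (A ((B.boost r).toEnd B.o)) = _
  rw [B.boost_o hr0, map_smul, map_smul, B.boost_inv hr0,
    B.boost_perp (inv_ne_zero hr0) ho hι]

theorem gauge_singularGauge {c : ℝ → LightCone n} {F : ℝ → Lorentz n} {A : End n} {t r' : ℝ}
    {r : ℝ → ℝ} (Q : ℝ → ℝ) (lam : ℝ)
    (hF : HasDerivAt (fun τ => (F τ).toEnd) ((F t).toEnd * A) t)
    (hlift : ∀ᶠ u in 𝓝 t, (F u).act B.oL.span = (c u).span)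
    (hc : DifferentiableAt ℝ (fun u => (c u : Mink n)) t)
    (hr : HasDerivAt r r' t) (hr0 : r t ≠ 0) (hι : mink n B.ι (A B.o) = 0) {ξ : Mink n}
    (hξ : (r t)⁻¹ • A B.o = ξ) :
    gauge (singularGauge B r F) (fun t => lam • assocForm c Q t) t =
      lam • (Q t / mink n ξ ξ) • wedge B.o ξ + wedge ξ B.ι - (r' / r t) • wedge B.o B.ι +
      (1 - (r t - 1) • rankOne B.o B.ι) * (A - wedge (A B.o) B.ι) *
        (1 - (r t - 1) • rankOne B.ι B.o) := by
  have hA := mink_skew_of_hasDerivAt hF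
  have hoA : mink n B.o (A B.o) = 0 := by linarith [hA B.o B.o, mink_comm B.o (A B.o)]
  have hoξ : mink n B.o ξ = 0 := by rw [← hξ, map_smul, hoA, smul_zero]
  have hMo : ((B.boost (r t))⁻¹.toEnd * A * (B.boost (r t)).toEnd -
      (r' / r t) • wedge B.o B.ι) B.oL = ξ - (r' / r t) • B.o := by
    rw [B.coe_oL, _root_.sub_apply, _root_.smul_apply, boost_conj_apply_o hr0 hoA hι,
      hξ, wedge_apply, B.o_o, B.ι_o]
    module
  have hnorm : mink n (ξ - (r' / r t) • B.o) (ξ - (r' / r t) • B.o) = mink n ξ ξ := by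
    simp [mink_comm ξ B.o, hoξ, B.o_o]
  have hwedge : wedge (B.oL : Mink n) (ξ - (r' / r t) • B.o) = wedge B.o ξ := by
    rw [B.coe_oL, wedge_sub, wedge_smul, wedge_self, smul_zero, sub_zero]
  have hglift : ∀ᶠ u in 𝓝 t, (singularGauge B r F u).act B.oL.span = (c u).span := by
    filter_upwards [hlift, hr.continuousAt.eventually_ne hr0] with u hu hru
    rw [singularGauge_act_oL hru, hu]
  rw [gauge_assocForm Q lam (hasDerivAt_singularGauge hF hr hr0) hglift hc, hMo, hnorm, hwedge,
    boost_conj hr0 hA hι, hξ]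
  abel

end SingularGauge

section SimplePole

variable {n : ℕ}

theorem div_mink_smul_wedge_isBigO {Q : ℝ → ℝ} {q : ℝ} {ξ : ℝ → Mink n} {u w : Mink n}
    (hw : mink n w w = 1) (hQ : (fun t => Q t * t ^ 2 - q) =O[𝓝[>] 0] fun t => t)
    (hξ : (fun t => ξ t - t⁻¹ • w) =O[𝓝[>] 0] fun _ => (1 : ℝ)) :
    (fun t => (Q t / mink n (ξ t) (ξ t)) • wedge u (ξ t) - t⁻¹ • q • wedge u w)
      =O[𝓝[>] 0] fun _ => (1 : ℝ) := by
  have hpos : ∀ᶠ t in 𝓝[>] (0 : ℝ), 0 < t := self_mem_nhdsWithin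
  have hid : Tendsto (fun t : ℝ => t) (𝓝[>] 0) (𝓝 0) := tendsto_id.mono_left nhdsWithin_le_nhds
  let Φ : ℝ × Mink n → End n := fun p => (p.1 / minkL n p.2 p.2) • wedgeL n u p.2
  have hΦ : DifferentiableAt ℝ Φ (q, w) := by
    have hw0 : minkL n w w ≠ 0 := hw.trans_ne one_ne_zero
    have hnorm : DifferentiableAt ℝ (fun p : ℝ × Mink n => minkL n p.2 p.2) (q, w) := by fun_prop
    have hquot : DifferentiableAt ℝ (fun p : ℝ × Mink n => p.1 / minkL n p.2 p.2) (q, w) := by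
      fun_prop (disch := exact hw0)
    exact hquot.fun_smul (by fun_prop)
  have hη : (fun t => t • ξ t - w) =O[𝓝[>] 0] fun t => t := by
    refine ((Asymptotics.isBigO_refl (fun t : ℝ => t) (𝓝[>] 0)).smul hξ).congr' ?_ (by simp)
    filter_upwards [hpos] with t ht
    rw [smul_sub, smul_inv_smul₀ ht.ne']
  have hp : (fun t => (Q t * t ^ 2, t • ξ t) - (q, w)) =O[𝓝[>] 0] fun t => t := hQ.prod_left hη
  have hlim : Tendsto (fun t => (Q t * t ^ 2, t • ξ t)) (𝓝[>] 0) (𝓝 (q, w)) := by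
    simpa using (hp.trans_tendsto hid).add_const (q, w)
  have hmain := (Asymptotics.isBigO_refl (fun t : ℝ => t⁻¹) (𝓝[>] 0)).smul
    ((hΦ.isBigO_sub.comp_tendsto hlim).trans hp)
  refine hmain.congr' ?_ ?_
  · filter_upwards [hpos] with t ht
    have hscale : Φ (Q t * t ^ 2, t • ξ t) = t • (Q t / mink n (ξ t) (ξ t)) • wedge u (ξ t) := by
      change (Q t * t ^ 2 / mink n (t • ξ t) (t • ξ t)) • wedge u (t • ξ t) = _
      rw [wedge_smul, smul_smul, smul_smul]
      congr 1
      simp only [map_smul, LinearMap.smul_apply, smul_eq_mul]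
      field_simp
    have hlimit : Φ (q, w) = q • wedge u w := by
      change (q / mink n w w) • wedge u w = _
      rw [hw, div_one]
    simp only [Function.comp_apply]
    rw [hscale, hlimit, smul_sub, inv_smul_smul₀ ht.ne']
  · filter_upwards [hpos] with t ht
    simp [ht.ne']

variable {B : PseudoTriple n}

theorem boost_remainder_isBigO {A : ℝ → End n} {r : ℝ → ℝ} {l : Filter ℝ}
    (hA : A =O[l] fun _ => (1 : ℝ)) (hr : r =O[l] fun _ => (1 : ℝ)) :
    (fun t => (1 - (r t - 1) • rankOne B.o B.ι) * (A t - wedge (A t B.o) B.ι) *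
        (1 - (r t - 1) • rankOne B.ι B.o)) =O[l] fun _ => (1 : ℝ) := by
  have hconst (M : End n) : (fun _ : ℝ => M) =O[l] fun _ => (1 : ℝ) :=
    Asymptotics.isBigO_const_const M one_ne_zero _
  have hfactor (M : End n) : (fun t => 1 - (r t - 1) • M) =O[l] fun _ => (1 : ℝ) :=
    (hconst 1).sub (by simpa using (hr.sub (Asymptotics.isBigO_refl _ _)).smul (hconst M))
  have hwedge : (fun t => wedge (A t B.o) B.ι) =O[l] fun _ => (1 : ℝ) :=
    (((wedgeL n).flip B.ι ∘L ContinuousLinearMap.apply ℝ (Mink n) B.o).isBigO_comp A l).trans hA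
  simpa using ((hfactor _).mul (hA.sub hwedge)).mul (hfactor _)

/-- `F` is a frame along `⟨c⟩` on `(0, b)` with connection form `F⁻¹ dF = A dt` which, together with
the scaling function `r`, is regular enough at `0` for the singular gauge transformation of `B`, `r`
and `F` to turn `λ ω` into a form with a simple pole: `A` is bounded, `⟪ι, A o⟫ = 0`, and both
`r'/r` and `r⁻¹ A o` have simple poles, with residues `1` and `τ`. -/
structure IsPolarFrame (B : PseudoTriple n) (c : ℝ → LightCone n) (r : ℝ → ℝ) (F : ℝ → Lorentz n)
    (A : ℝ → End n) (b : ℝ) : Prop where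
  hasDerivAt : ∀ t ∈ Ioo 0 b, HasDerivAt (fun τ => (F τ).toEnd) ((F t).toEnd * A t) t
  lift : ∀ t ∈ Ioo 0 b, (F t).act B.oL.span = (c t).span
  differentiableAt_curve : ∀ t ∈ Ioo 0 b, DifferentiableAt ℝ (fun u => (c u : Mink n)) t
  differentiableAt_scale : ∀ t ∈ Ioo 0 b, DifferentiableAt ℝ r t
  scale_ne_zero : ∀ t ∈ Ioo 0 b, r t ≠ 0
  scale_isBigO : r =O[𝓝[>] 0] fun _ => (1 : ℝ)
  logDeriv_isBigO : (fun t => deriv r t / r t - t⁻¹) =O[𝓝[>] 0] fun _ => (1 : ℝ)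
  form_isBigO : A =O[𝓝[>] 0] fun _ => (1 : ℝ)
  mink_ι : ∀ t ∈ Ioo 0 b, mink n B.ι (A t B.o) = 0
  tangent_isBigO : (fun t => (r t)⁻¹ • A t B.o - t⁻¹ • B.τ) =O[𝓝[>] 0] fun _ => (1 : ℝ)

namespace IsPolarFrame

variable {c : ℝ → LightCone n} {r : ℝ → ℝ} {F : ℝ → Lorentz n} {A : ℝ → End n} {b : ℝ}

theorem gauge_isBigO (h : IsPolarFrame B c r F A b) (hb : 0 < b) {Q : ℝ → ℝ} {q : ℝ}
    (hQ : (fun t => Q t * t ^ 2 - q) =O[𝓝[>] 0] fun t => t) (lam : ℝ) :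
    (fun t => gauge (singularGauge B r F) (fun t => lam • assocForm c Q t) t +
      t⁻¹ • B.residue (lam * q)) =O[𝓝[>] 0] fun _ => (1 : ℝ) := by
  have hconst (M : End n) : (fun _ : ℝ => M) =O[𝓝[>] 0] fun _ => (1 : ℝ) :=
    Asymptotics.isBigO_const_const M one_ne_zero _
  have hω := (div_mink_smul_wedge_isBigO (u := B.o) B.τ_τ hQ h.tangent_isBigO).const_smul_left lam
  have hξ := (((wedgeL n).flip B.ι).isBigO_comp _ _).trans h.tangent_isBigO
  have hr : (fun t => (deriv r t / r t - t⁻¹) • wedge B.o B.ι) =O[𝓝[>] 0] fun _ => (1 : ℝ) := by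
    simpa using h.logDeriv_isBigO.smul (hconst (wedge B.o B.ι))
  have hA := boost_remainder_isBigO (B := B) h.form_isBigO h.scale_isBigO
  refine (((hω.add hξ).sub hr).add hA).congr' ?_ .rfl
  filter_upwards [Ioo_mem_nhdsGT hb] with t ht
  have hlift : ∀ᶠ u in 𝓝 t, (F u).act B.oL.span = (c u).span :=
    mem_of_superset (isOpen_Ioo.mem_nhds ht) h.lift
  have hwedge : (wedgeL n).flip B.ι ((r t)⁻¹ • A t B.o - t⁻¹ • B.τ) =
    wedge ((r t)⁻¹ • A t B.o - t⁻¹ • B.τ) B.ι := rfl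
  rw [gauge_singularGauge Q lam (h.hasDerivAt t ht) hlift (h.differentiableAt_curve t ht)
    (h.differentiableAt_scale t ht).hasDerivAt (h.scale_ne_zero t ht) (h.mink_ι t ht) rfl, hwedge,
    Pi.smul_apply, sub_wedge, smul_wedge t⁻¹, B.residue_eq]
  module

theorem differentiableAt_singularGauge (h : IsPolarFrame B c r F A b) {t : ℝ} (ht : t ∈ Ioo 0 b) :
    DifferentiableAt ℝ (fun τ => (singularGauge B r F τ).toEnd) t :=
  (hasDerivAt_singularGauge (h.hasDerivAt t ht) (h.differentiableAt_scale t ht).hasDerivAt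
    (h.scale_ne_zero t ht)).differentiableAt

theorem singularGauge_lift (h : IsPolarFrame B c r F A b) {t : ℝ} (ht : t ∈ Ioo 0 b) :
    (singularGauge B r F t).act B.oL.span = (c t).span :=
  (singularGauge_act_oL (h.scale_ne_zero t ht)).trans (h.lift t ht)

end IsPolarFrame

theorem HasPole.isBigO {Q : ℝ → ℝ} {b q : ℝ} (hb : 0 < b) (h : HasPole Q 0 b 2 q) :
    (fun t => Q t * t ^ 2 - q) =O[𝓝[>] 0] fun t => t := by
  obtain ⟨-, e, he, f, hf, hfQ, hf0⟩ := h
  have hd : DifferentiableAt ℝ f 0 :=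
    (hf.contDiffAt (Ioo_mem_nhds (by linarith) hb)).differentiableAt (by simp)
  have h1 := hd.isBigO_sub.mono (nhdsWithin_le_nhds (s := Ioi 0))
  simp only [sub_zero, hf0] at h1
  refine h1.congr' ?_ .rfl
  filter_upwards [Ioo_mem_nhdsGT hb] with t ht
  rw [hfQ t ht, zero_sub, neg_sq]

end SimplePole

section PrimitiveLimits

variable {n : ℕ} {B : PseudoTriple n} {G : ℝ → Lorentz n}

theorem mink_self_eq_zero_of_tendsto {α : Type*} {l : Filter α} [l.NeBot] {a : α → ℝ}
    {T : α → Lorentz n} {v : LightCone n} {x : Mink n}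
    (h : Tendsto (fun i => a i • (T i).toEnd v) l (𝓝 x)) : mink n x x = 0 := by
  refine tendsto_nhds_unique ((continuous_mink.tendsto (x, x)).comp (h.prodMk_nhds h))
    (tendsto_const_nhds.congr fun i => ?_)
  simp only [Function.comp_apply, map_smul, LinearMap.smul_apply, Lorentz.mink_toEnd, v.2.2,
    smul_zero]

theorem exists_primitive_asymptotics {ψ : ℝ → End n} {μ : ℝ} (hμ : 0 ≤ 1 - 2 * μ)
    (hψ : (fun t => ψ t + t⁻¹ • B.residue μ) =O[𝓝[>] 0] fun _ => (1 : ℝ))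
    (hG : ∀ᶠ t in 𝓝[>] 0, HasDerivAt (fun τ => (G τ).toEnd) ((G t).toEnd * ψ t) t) :
    ∃ k : LightCone n,
      Tendsto (fun t => t ^ (-√(1 - 2 * μ)) • (G t)⁻¹.toEnd k) (𝓝[>] 0) (𝓝 (B.vPlus μ)) ∧
      ∃ φ : ℝ → ℝ, (∀ᶠ t in 𝓝[>] 0, φ t ≠ 0) ∧
        Tendsto (fun t => φ t • (G t).toEnd) (𝓝[>] 0) (𝓝 (rankOne k (B.vMinus μ))) := by
  obtain ⟨W, hW⟩ : ∃ W, W = -rankOne (B.vPlus μ : Mink n) (B.vMinus μ) := ⟨_, rfl⟩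
  have hYW : B.residue μ * W = √(1 - 2 * μ) • W := by
    rw [hW, smul_neg, ← B.residue_mul_rankOne hμ]
    exact mul_neg (B.residue μ) _
  have hWapply (x : Mink n) : W x = -mink n (B.vMinus μ) x • (B.vPlus μ : Mink n) := by
    rw [hW, _root_.neg_apply, rankOne_apply, neg_smul]
  have hWo : W B.o = B.vPlus μ := by
    rw [hWapply, B.mink_vMinus_o, neg_neg, one_smul]
  obtain ⟨K, hK, hK', φ, hφ, hφK⟩ := exists_singular_asymptotics (G := fun t => (G t).toUnit)
    (Real.sqrt_nonneg _) (hW ▸ B.residue_mul_self hμ) hYW hG hψ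
  have happly {T : ℝ → End n} {S : End n} (h : Tendsto T (𝓝[>] 0) (𝓝 S)) (x : Mink n) :
      Tendsto (fun t => T t x) (𝓝[>] 0) (𝓝 (S x)) :=
    ((ContinuousLinearMap.apply ℝ (Mink n) x).continuous.tendsto S).comp h
  have hKx (x : Mink n) : Tendsto (fun t => t ^ √(1 - 2 * μ) • (G t).toEnd (W x)) (𝓝[>] 0)
      (𝓝 (K x)) := happly hK x
  have hKo : Tendsto (fun t => t ^ (-√(1 - 2 * μ)) • (G t)⁻¹.toEnd (K B.o)) (𝓝[>] 0)
      (𝓝 (B.vPlus μ)) := hWo ▸ happly hK' B.o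
  have hne : K B.o ≠ 0 := fun h => (B.vPlus μ).2.1 <|
    tendsto_nhds_unique hKo (by simp only [h, map_zero, smul_zero, tendsto_const_nhds])
  have hKeq : K = -rankOne (K B.o) (B.vMinus μ) := by
    ext1 x
    rw [_root_.neg_apply, rankOne_apply, ← neg_smul]
    refine tendsto_nhds_unique (hKx x) (((hKx B.o).const_smul _).congr fun t => ?_)
    rw [hWo, hWapply, map_smul, smul_comm]
  refine ⟨⟨K B.o, hne, ?_⟩, hKo, fun t => -(φ t)⁻¹, ?_, ?_⟩
  · exact mink_self_eq_zero_of_tendsto (v := B.vPlus μ) (hWo ▸ hKx B.o)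
  · filter_upwards [hφ.eventually_gt_atTop 0] with t ht using neg_ne_zero.2 (inv_ne_zero ht.ne')
  · rw [← neg_neg (rankOne _ _), ← hKeq]
    exact hφK.neg.congr fun t => (neg_smul _ _).symm

theorem tendsto_calapso {c : ℝ → LightCone n} {Γ g : ℝ → Lorentz n} {φ : ℝ → ℝ}
    {v k : LightCone n} {w : Mink n} (hw : mink n w v ≠ 0)
    (hlift : ∀ᶠ t in 𝓝[>] 0, (g t).act v.span = (c t).span) (hφ : ∀ᶠ t in 𝓝[>] 0, φ t ≠ 0)
    (h : Tendsto (fun t => φ t • (Γ t * g t).toEnd) (𝓝[>] 0) (𝓝 (rankOne k w))) :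
    Tendsto (calapso c Γ) (𝓝[>] 0) (𝓝 k.span) := by
  have hv : Tendsto (fun t => ((mink n w v)⁻¹ * φ t) • ((Γ t * g t).actCone v : Mink n)) (𝓝[>] 0)
      (𝓝 k) := by
    have := (((ContinuousLinearMap.apply ℝ (Mink n) (v : Mink n)).continuous.tendsto _).comp
      h).const_smul (mink n w v)⁻¹
    simp only [ContinuousLinearMap.apply_apply, rankOne_apply, inv_smul_smul₀ hw] at this
    exact this.congr fun t => smul_smul _ _ _
  refine (LightCone.tendsto_span (hφ.mono fun t => mul_ne_zero (inv_ne_zero hw)) hv).congr' ?_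
  filter_upwards [hlift] with t ht
  rw [calapso, ← ht]
  rfl

end PrimitiveLimits

section NullRotation

variable {n : ℕ}

namespace PseudoTriple

theorem exists_of_null_of_unit {o τ : Mink n} (ho : o ≠ 0) (hoo : mink n o o = 0)
    (hττ : mink n τ τ = 1) (hoτ : mink n o τ = 0) :
    ∃ B : PseudoTriple n, B.o = o ∧ B.τ = τ := by
  obtain ⟨y, hy⟩ := mink_nondegenerate ho
  set z := -(mink n o y)⁻¹ • (y - mink n y τ • τ) with hz
  have hoz : mink n o z = -1 := by
    simp only [hz, map_smul, map_sub, smul_eq_mul, hoτ, mul_zero, sub_zero, neg_mul,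
      inv_mul_cancel₀ hy]
  have hzτ : mink n z τ = 0 := by
    simp only [hz, map_smul, map_sub, LinearMap.smul_apply, LinearMap.sub_apply, smul_eq_mul, hττ,
      mul_one, sub_self, mul_zero]
  refine ⟨⟨o, z + (mink n z z / 2) • o, τ, hoo, ?_, ?_, hττ, hoτ, ?_⟩, rfl, rfl⟩ <;>
    simp only [map_add, map_smul, LinearMap.add_apply, LinearMap.smul_apply, smul_eq_mul, hoo, hoz,
      hoτ, hzτ, mink_comm z o] <;> ring

variable (B : PseudoTriple n)

/-- The orthogonal projection onto the complement of `o` and `ι`. -/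
def proj : End n := 1 + rankOne B.o B.ι + rankOne B.ι B.o

theorem proj_apply (x : Mink n) : B.proj x = x + mink n B.ι x • B.o + mink n B.o x • B.ι := rfl

theorem mink_o_proj (x : Mink n) : mink n B.o (B.proj x) = 0 := by
  simp [proj_apply, B.o_o, B.o_ι]

theorem mink_ι_proj (x : Mink n) : mink n B.ι (B.proj x) = 0 := by
  simp [proj_apply, B.ι_ι, B.ι_o]

theorem proj_τ : B.proj B.τ = B.τ := by
  simp [proj_apply, B.ι_τ, B.o_τ]

theorem wedge_proj_ι_o (x : Mink n) : wedge (B.proj x) B.ι B.o = B.proj x := by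
  rw [wedge_apply, mink_comm, B.mink_o_proj, B.ι_o, zero_smul, zero_sub, neg_one_smul, neg_neg]

/-- The null rotation which fixes `ι` and maps `o` to `o + y + (⟪y, y⟫ / 2) ι`, where `y` is the
projection of `x` onto the complement of `o` and `ι`. -/
def nullRotation (x : Mink n) : Lorentz n :=
  Lorentz.ofIsometry
    (LinearMap.id + (wedge (B.proj x) B.ι).toLinearMap -
      (mink n (B.proj x) (B.proj x) / 2) • (rankOne B.ι B.ι).toLinearMap) <| by
    intro u v
    change mink n (u + wedge (B.proj x) B.ι u -
        (mink n (B.proj x) (B.proj x) / 2) • rankOne B.ι B.ι u)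
      (v + wedge (B.proj x) B.ι v -
        (mink n (B.proj x) (B.proj x) / 2) • rankOne B.ι B.ι v) = mink n u v
    simp only [wedge_apply, rankOne_apply, map_sub, map_add, map_smul, LinearMap.sub_apply,
      LinearMap.add_apply, LinearMap.smul_apply, smul_eq_mul, B.ι_ι, B.mink_ι_proj,
      mink_comm (B.proj x) B.ι, mink_comm u B.ι, mink_comm u (B.proj x)]
    ring

theorem toEnd_nullRotation (x : Mink n) : (B.nullRotation x).toEnd =
    1 + wedge (B.proj x) B.ι - (mink n (B.proj x) (B.proj x) / 2) • rankOne B.ι B.ι := rfl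

theorem nullRotation_o {f : Mink n} (hι : mink n B.ι f = -1) (hf : mink n f f = 0) :
    (B.nullRotation f).toEnd B.o = f := by
  have hproj : mink n (B.proj f) (B.proj f) = -2 * mink n B.o f := by
    simp only [B.proj_apply, map_add, map_smul, LinearMap.add_apply, LinearMap.smul_apply,
      smul_eq_mul, hf, hι, B.o_o, B.ι_ι, B.o_ι, B.ι_o, mink_comm f B.o, mink_comm f B.ι]
    ring
  change B.o + wedge (B.proj f) B.ι B.o -
    (mink n (B.proj f) (B.proj f) / 2) • rankOne B.ι B.ι B.o = f
  rw [B.wedge_proj_ι_o, rankOne_apply, B.ι_o, hproj, B.proj_apply, hι]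
  module

theorem hasDerivAt_nullRotation {x : ℝ → Mink n} {x' : Mink n} {t : ℝ} (hx : HasDerivAt x x' t) :
    HasDerivAt (fun u => (B.nullRotation (x u)).toEnd)
      ((B.nullRotation (x t)).toEnd * wedge (B.proj x') B.ι) t := by
  have hy : HasDerivAt (fun u => B.proj (x u)) (B.proj x') t :=
    B.proj.hasFDerivAt.comp_hasDerivAt t hx
  have hw : HasDerivAt (fun u => wedge (B.proj (x u)) B.ι) (wedge (B.proj x') B.ι) t :=
    ((wedgeL n).flip B.ι).hasFDerivAt.comp_hasDerivAt t hy
  refine ((hw.const_add 1).sub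
    (((hasDerivAt_mink hy hy).div_const 2).smul_const (rankOne B.ι B.ι))).congr_deriv ?_
  rw [B.toEnd_nullRotation]
  ext1 z
  change wedge (B.proj x') B.ι z - ((mink n (B.proj (x t)) (B.proj x') +
      mink n (B.proj x') (B.proj (x t))) / 2) • rankOne B.ι B.ι z =
    wedge (B.proj x') B.ι z + wedge (B.proj (x t)) B.ι (wedge (B.proj x') B.ι z) -
      (mink n (B.proj (x t)) (B.proj (x t)) / 2) • rankOne B.ι B.ι (wedge (B.proj x') B.ι z)
  simp only [wedge_apply, rankOne_apply, map_sub, map_smul, B.ι_ι, B.mink_ι_proj,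
    mink_comm (B.proj (x t)) B.ι, mink_comm (B.proj x') (B.proj (x t))]
  module

end PseudoTriple

end NullRotation

section Existence

variable {n : ℕ} {c : ℝ → LightCone n}

theorem IsRegularLift.differentiableAt {I : Set ℝ} {t : ℝ} (hc : IsRegularLift c I)
    (hI : I ∈ 𝓝 t) : DifferentiableAt ℝ (fun u => (c u : Mink n)) t :=
  (hc.smooth.contDiffAt hI).differentiableAt (by simp)

theorem IsRegularLift.exists_adapted_triple {I : Set ℝ} {t₀ : ℝ} (hc : IsRegularLift c I)
    (hI : I ∈ 𝓝 t₀) : ∃ (B : PseudoTriple n) (m : ℝ), m ≠ 0 ∧ (c t₀ : Mink n) = m • B.o ∧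
      HasDerivAt (fun t => (c t : Mink n)) (m • B.τ) t₀ := by
  have hd := (hc.differentiableAt hI).hasDerivAt
  set c' := deriv (fun t => (c t : Mink n)) t₀
  have hcc' : mink n (c t₀ : Mink n) c' = 0 := LightCone.mink_deriv_eq_zero hd
  have hpos : 0 < mink n c' c' :=
    mink_self_pos (c t₀).2.2 hcc' (hc.immersion t₀ (mem_of_mem_nhds hI))
  set m := √(mink n c' c')
  have hm : m ≠ 0 := (Real.sqrt_pos.2 hpos).ne'
  have hmm : m * m = mink n c' c' := Real.mul_self_sqrt hpos.le
  obtain ⟨B, ho, hτ⟩ := PseudoTriple.exists_of_null_of_unit (o := m⁻¹ • (c t₀ : Mink n))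
    (τ := m⁻¹ • c') (smul_ne_zero (inv_ne_zero hm) (c t₀).2.1) (by simp [(c t₀).2.2])
    (by simp [← hmm, hm]) (by simp [hcc'])
  exact ⟨B, m, hm, by rw [ho, smul_inv_smul₀ hm], by rwa [hτ, smul_inv_smul₀ hm]⟩

theorem IsRegularLift.exists_normalized_lift {I : Set ℝ} {t₀ : ℝ} (hc : IsRegularLift c I)
    (hI : I ∈ 𝓝 t₀) : ∃ (B : PseudoTriple n) (f : ℝ → Mink n), ContDiffAt ℝ ∞ f t₀ ∧
      deriv f t₀ = B.τ ∧
      ∀ᶠ t in 𝓝 t₀, mink n B.ι (f t) = -1 ∧ ∃ a : ℝ, a ≠ 0 ∧ f t = a • (c t : Mink n) := by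
  obtain ⟨B, m, hm, hct₀, hcd⟩ := hc.exists_adapted_triple hI
  set d : ℝ → ℝ := fun t => -mink n B.ι (c t) with hd_def
  have hcs : ContDiffAt ℝ ∞ (fun t => (c t : Mink n)) t₀ := hc.smooth.contDiffAt hI
  have hds : ContDiffAt ℝ ∞ d t₀ := ((minkL n B.ι).contDiff.contDiffAt.comp t₀ hcs).neg
  have hdt₀ : d t₀ = m := by simp [hd_def, hct₀, B.ι_o]
  have hd0 : d t₀ ≠ 0 := hdt₀.trans_ne hm
  have hdd : HasDerivAt d 0 t₀ :=
    (hasDerivAt_mink (hasDerivAt_const t₀ B.ι) hcd).neg.congr_deriv (by simp [B.ι_τ])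
  refine ⟨B, fun t => (d t)⁻¹ • (c t : Mink n), (hds.inv hd0).smul hcs, ?_, ?_⟩
  · refine ((hdd.inv hd0).smul hcd).deriv.trans ?_
    simp [hdt₀, hm]
  · filter_upwards [hds.continuousAt.eventually_ne hd0] with t ht
    refine ⟨?_, (d t)⁻¹, inv_ne_zero ht, rfl⟩
    rw [map_smul, smul_eq_mul, ← neg_neg (mink n B.ι (c t)), mul_neg, inv_mul_cancel₀ ht]

theorem isPolarFrame_nullRotation {B : PseudoTriple n} {f : ℝ → Mink n} {b : ℝ}
    (hf : ContDiffAt ℝ 2 f 0) (hτ : deriv f 0 = B.τ)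
    (hfd : ∀ t ∈ Ioo 0 b, DifferentiableAt ℝ f t)
    (hcd : ∀ t ∈ Ioo 0 b, DifferentiableAt ℝ (fun u => (c u : Mink n)) t)
    (hfι : ∀ t ∈ Ioo 0 b, mink n B.ι (f t) = -1)
    (hfc : ∀ t ∈ Ioo 0 b, ∃ a : ℝ, a ≠ 0 ∧ f t = a • (c t : Mink n)) :
    IsPolarFrame B c (fun t => t) (fun t => B.nullRotation (f t))
      (fun t => wedge (B.proj (deriv f t)) B.ι) b := by
  have hf' : DifferentiableAt ℝ (deriv f) 0 :=
    ((hf.fderiv_right (m := 1) (by norm_num)).clm_apply contDiffAt_const).differentiableAt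
      (by simp)
  have hproj : (fun t => B.proj (deriv f t) - B.τ) =O[𝓝[>] 0] fun t => t := by
    have := (B.proj.isBigO_comp _ _).trans (hf'.isBigO_sub.mono (nhdsWithin_le_nhds (s := Ioi 0)))
    simpa only [hτ, map_sub, B.proj_τ, sub_zero] using this
  have hA : ContinuousAt (fun t => wedge (B.proj (deriv f t)) B.ι) 0 :=
    (((wedgeL n).flip B.ι).continuous.comp B.proj.continuous).continuousAt.comp hf'.continuousAt
  have hinv : (fun t : ℝ => t⁻¹ * t) =ᶠ[𝓝[>] 0] fun _ => 1 := by
    filter_upwards [self_mem_nhdsWithin] with t ht using inv_mul_cancel₀ (ne_of_gt ht)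
  refine ⟨fun t ht => B.hasDerivAt_nullRotation (hfd t ht).hasDerivAt, fun t ht => ?_, hcd,
    fun t _ => differentiableAt_id, fun t ht => ht.1.ne', ?_, ?_, ?_, fun t _ => ?_, ?_⟩
  · obtain ⟨a, ha, hac⟩ := hfc t ht
    have hff : mink n (f t) (f t) = 0 := by simp [hac, (c t).2.2]
    rw [Lorentz.act_span, LightCone.span_eq_iff]
    exact ⟨a, ha, (B.nullRotation_o (hfι t ht) hff).trans hac⟩
  · exact (tendsto_id.mono_left nhdsWithin_le_nhds).isBigO_one ℝ
  · refine (Asymptotics.isBigO_zero _ _).congr_left fun t => ?_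
    rw [deriv_id'', one_div, sub_self]
  · exact (hA.tendsto.mono_left nhdsWithin_le_nhds).isBigO_one ℝ
  · rw [B.wedge_proj_ι_o, B.mink_ι_proj]
  · refine ((Asymptotics.isBigO_refl (fun t : ℝ => t⁻¹) (𝓝[>] 0)).smul hproj).congr' ?_ hinv
    exact .of_forall fun t => by simp only [B.wedge_proj_ι_o, smul_sub]

theorem exists_isPolarFrame {ε b : ℝ} (hε : 0 < ε) (hb : 0 < b)
    (hc : IsRegularLift c (Ioo (-ε) b)) : ∃ (B : PseudoTriple n) (r : ℝ → ℝ) (F : ℝ → Lorentz n)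
      (A : ℝ → End n) (a : ℝ), a ∈ Ioc 0 b ∧ IsPolarFrame B c r F A a := by
  obtain ⟨B, f, hf, hτ, hfc⟩ := hc.exists_normalized_lift (Ioo_mem_nhds (neg_lt_zero.2 hε) hb)
  have hf2 : ContDiffAt ℝ 2 f 0 := hf.of_le (by norm_cast)
  have hfd : ∀ᶠ t in 𝓝 0, DifferentiableAt ℝ f t :=
    (hf2.eventually (by simp)).mono fun t ht => ht.differentiableAt (by simp)
  obtain ⟨a, ha, hsub⟩ := mem_nhdsGT_iff_exists_Ioo_subset.1
    (nhdsWithin_le_nhds (s := Ioi 0) (hfd.and hfc))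
  have h {t : ℝ} (ht : t ∈ Ioo 0 (min a b)) := hsub ⟨ht.1, ht.2.trans_le (min_le_left a b)⟩
  have hcd {t : ℝ} (ht : t ∈ Ioo 0 (min a b)) :=
    hc.differentiableAt (Ioo_mem_nhds (by linarith [ht.1]) (ht.2.trans_le (min_le_right a b)))
  exact ⟨B, _, _, _, min a b, ⟨lt_min ha hb, min_le_right a b⟩, isPolarFrame_nullRotation hf2 hτ
    (fun t ht => (h ht).1) (fun t ht => hcd ht) (fun t ht => (h ht).2.1) fun t ht => (h ht).2.2⟩

theorem exists_tendsto_calapso {ε b : ℝ} (hε : 0 < ε) (hb : 0 < b)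
    (hc : IsRegularLift c (Ioo (-ε) b)) {Q : ℝ → ℝ} {q : ℝ} (hpole : HasPole Q 0 b 2 q) {lam : ℝ}
    (hlam : 0 ≤ 1 - 2 * (lam * q)) {p : ℝ} {Γ : ℝ → Lorentz n}
    (hΓ : IsPrimitive (fun t => lam • assocForm c Q t) (Ioo 0 b) p Γ) :
    ∃ P : Sphere n, Tendsto (calapso c Γ) (𝓝[>] 0) (𝓝 P) := by
  obtain ⟨B, r, F, A, a, ⟨ha, hab⟩, hF⟩ := exists_isPolarFrame hε hb hc
  have hnear : ∀ᶠ t in 𝓝[>] 0, t ∈ Ioo 0 a := Ioo_mem_nhdsGT ha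
  obtain ⟨k, -, φ, hφ, hk⟩ := exists_primitive_asymptotics
    (G := fun t => Γ t * singularGauge B r F t) hlam (hF.gauge_isBigO ha (hpole.isBigO hb) lam) <|
      hnear.mono fun t ht => hasDerivAt_mul_gauge (hΓ.hasDerivAt t ⟨ht.1, ht.2.trans_le hab⟩)
        (hF.differentiableAt_singularGauge ht)
  exact ⟨k.span, tendsto_calapso (v := B.oL) (by simp [B.coe_oL, B.mink_vMinus_o])
    (hnear.mono fun t => hF.singularGauge_lift) hφ hk⟩

end Existence

namespace IsPolarParameter

variable {Q s : ℝ → ℝ} {q δ b : ℝ}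

theorem pos (hs : IsPolarParameter Q q δ b s) (hδ : 0 < δ) {t : ℝ} (ht : t ∈ Ioo 0 b) :
    0 < s t := by
  have hmono : StrictMonoOn s (Ioo (-δ) b) := strictMonoOn_of_deriv_pos (convex_Ioo (-δ) b)
    hs.smooth.continuousOn fun x hx => hs.deriv_pos x (by rwa [interior_Ioo] at hx)
  have := hmono ⟨neg_lt_zero.2 hδ, ht.1.trans ht.2⟩ ⟨by linarith [ht.1], ht.2⟩ ht.1
  rwa [hs.zero] at this

theorem differentiableAt (hs : IsPolarParameter Q q δ b s) {t : ℝ} (ht : t ∈ Ioo (-δ) b) :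
    DifferentiableAt ℝ s t :=
  (hs.smooth.contDiffAt (Ioo_mem_nhds ht.1 ht.2)).differentiableAt (by simp)

theorem logDeriv_isBigO (hs : IsPolarParameter Q q δ b s) (hδ : 0 < δ) (hb : 0 < b)
    (hpole : HasPole Q 0 b 2 q) :
    (fun t => deriv s t / s t - t⁻¹) =O[𝓝[>] 0] fun _ => (1 : ℝ) := by
  -- With `x = t s' / s > 0`, the equation `Q = q s'² / s²` reads `t² Q - q = q (x + 1) (x - 1)`,
  -- where `x + 1 > 1`.
  have hx : (fun t => t * (deriv s t / s t) - 1) =O[𝓝[>] 0] fun t => Q t * t ^ 2 - q := by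
    refine .of_bound |q|⁻¹ ?_
    filter_upwards [Ioo_mem_nhdsGT hb] with t ht
    have hst := hs.pos hδ ht
    have hs't := hs.deriv_pos t ⟨by linarith [ht.1], ht.2⟩
    have hx0 : 0 < t * (deriv s t / s t) := mul_pos ht.1 (div_pos hs't hst)
    have hfactor : Q t * t ^ 2 - q =
        q * ((t * (deriv s t / s t) + 1) * (t * (deriv s t / s t) - 1)) := by
      rw [hs.eq t ht]
      ring
    rw [hfactor, norm_mul, norm_mul, Real.norm_eq_abs q,
      inv_mul_cancel_left₀ (abs_pos.2 hpole.1).ne']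
    refine le_mul_of_one_le_left (norm_nonneg _) ?_
    rw [Real.norm_of_nonneg (by linarith)]
    linarith
  refine ((Asymptotics.isBigO_refl (fun t : ℝ => t⁻¹) (𝓝[>] 0)).mul
    (hx.trans (hpole.isBigO hb))).congr' ?_ ?_ <;>
  · filter_upwards [self_mem_nhdsWithin] with t (ht : 0 < t)
    field_simp

end IsPolarParameter

namespace IsFrame

variable {n : ℕ} {B : PseudoTriple n} {c : ℝ → LightCone n} {s : ℝ → ℝ} {F : ℝ → Lorentz n}

theorem hasDerivAt {I : Set ℝ} {t : ℝ} (hF : IsFrame B c s I F) (hI : I ∈ 𝓝 t) :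
    HasDerivAt (fun τ => (F τ).toEnd)
      ((F t).toEnd * ((F t)⁻¹.toEnd * deriv (fun τ => (F τ).toEnd) t)) t := by
  rw [← mul_assoc, Lorentz.toEnd_mul_inv, one_mul]
  exact ((hF.smooth.contDiffAt hI).differentiableAt (by simp)).hasDerivAt

theorem inv_mul_deriv_apply_o {I : Set ℝ} {t : ℝ} (hF : IsFrame B c s I F) (hI : I ∈ 𝓝 t) :
    ((F t)⁻¹.toEnd * deriv (fun τ => (F τ).toEnd) t) B.o = deriv s t • B.τ := by
  have h := (hasDerivAt_mul_apply (hF.hasDerivAt hI) B.o).deriv.symm.trans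
    (hF.tangent t (mem_of_mem_nhds hI))
  rw [← map_smul] at h
  rw [← (F t).inv_apply (deriv s t • B.τ), ← h, Lorentz.inv_apply]

theorem continuousAt_inv_mul_deriv {I : Set ℝ} {t : ℝ} (hF : IsFrame B c s I F) (hI : I ∈ 𝓝 t) :
    ContinuousAt (fun t => (F t)⁻¹.toEnd * deriv (fun τ => (F τ).toEnd) t) t := by
  have hF' : ContinuousAt (deriv fun τ => (F τ).toEnd) t :=
    (((hF.smooth.contDiffAt hI).fderiv_right (m := 0) (by simp)).clm_apply
      contDiffAt_const).continuousAt
  exact (Lorentz.hasDerivAt_inv (hF.hasDerivAt hI)).continuousAt.mul hF'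

theorem isPolarFrame {Q : ℝ → ℝ} {q ε δ b : ℝ} (hF : IsFrame B c s (Ioo (-δ) b) F) (hδ : 0 < δ)
    (hδε : δ ≤ ε) (hb : 0 < b) (hc : IsRegularLift c (Ioo (-ε) b))
    (hs : IsPolarParameter Q q δ b s) (hpole : HasPole Q 0 b 2 q) :
    IsPolarFrame B c s F (fun t => (F t)⁻¹.toEnd * deriv (fun τ => (F τ).toEnd) t) b := by
  have hsub {t : ℝ} (ht : t ∈ Ioo 0 b) : t ∈ Ioo (-δ) b := ⟨by linarith [ht.1], ht.2⟩
  have hnhds {t : ℝ} (ht : t ∈ Ioo (-δ) b) : Ioo (-δ) b ∈ 𝓝 t := Ioo_mem_nhds ht.1 ht.2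
  have h0 : (0 : ℝ) ∈ Ioo (-δ) b := ⟨neg_lt_zero.2 hδ, hb⟩
  have hAo {t : ℝ} (ht : t ∈ Ioo 0 b) := hF.inv_mul_deriv_apply_o (hnhds (hsub ht))
  have hlog := hs.logDeriv_isBigO hδ hb hpole
  refine ⟨fun t ht => hF.hasDerivAt (hnhds (hsub ht)), fun t ht => hF.lift t (hsub ht),
    fun t ht => hc.differentiableAt (Ioo_mem_nhds (by linarith [ht.1]) ht.2),
    fun t ht => hs.differentiableAt (hsub ht), fun t ht => (hs.pos hδ ht).ne', ?_, hlog, ?_,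
    fun t ht => by rw [hAo ht, map_smul, B.ι_τ, smul_zero], ?_⟩
  · exact ((hs.differentiableAt h0).continuousAt.tendsto.mono_left
      nhdsWithin_le_nhds).isBigO_one ℝ
  · exact ((hF.continuousAt_inv_mul_deriv (hnhds h0)).tendsto.mono_left
      nhdsWithin_le_nhds).isBigO_one ℝ
  · refine (hlog.smul (Asymptotics.isBigO_const_const B.τ (one_ne_zero (α := ℝ)) _)).congr' ?_
      (by simp)
    filter_upwards [Ioo_mem_nhdsGT hb] with t ht
    rw [hAo ht, sub_smul, smul_smul, div_eq_inv_mul]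

end IsFrame

section ConeCurve

variable {n : ℕ}

theorem mul_rankOne (T : End n) (v w : Mink n) : T * rankOne v w = rankOne (T v) w := by
  ext1 x
  exact map_smul T (mink n w x) v

theorem smul_rankOne (a : ℝ) (v w : Mink n) : a • rankOne v w = rankOne (a • v) w := by
  ext1 x
  exact smul_comm a (mink n w x) v

theorem Lorentz.mul_act (S T : Lorentz n) (P : Sphere n) : (S * T).act P = S.act (T.act P) := by
  obtain ⟨P, hP⟩ := P
  induction P with
  | h v hv => rfl

/-- The light cone curve `k` with `k(t) = t ^ (-ζ) G(t)⁻¹ k₀` for `t > 0`, extended by the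
constant `v₀` to `t ≤ 0`. -/
def coneCurve (ζ : ℝ) (G : ℝ → Lorentz n) (k₀ v₀ : LightCone n) (t : ℝ) : LightCone n :=
  if ht : 0 < t then
    ⟨t ^ (-ζ) • ((G t)⁻¹.actCone k₀ : Mink n),
      smul_ne_zero (Real.rpow_pos_of_pos ht _).ne' ((G t)⁻¹.actCone k₀).2.1,
      by simp [((G t)⁻¹.actCone k₀).2.2]⟩
  else v₀

variable {ζ : ℝ} {G : ℝ → Lorentz n} {k₀ v₀ : LightCone n}

theorem coneCurve_zero : coneCurve ζ G k₀ v₀ 0 = v₀ := dif_neg (lt_irrefl 0)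

theorem coe_coneCurve {t : ℝ} (ht : 0 < t) :
    (coneCurve ζ G k₀ v₀ t : Mink n) = t ^ (-ζ) • (G t)⁻¹.toEnd k₀ := by
  rw [coneCurve, dif_pos ht]
  rfl

theorem span_coneCurve {t : ℝ} (ht : 0 < t) :
    (coneCurve ζ G k₀ v₀ t).span = (G t)⁻¹.act k₀.span := by
  rw [Lorentz.act_span, LightCone.span_eq_iff]
  exact ⟨t ^ (-ζ), (Real.rpow_pos_of_pos ht _).ne', coe_coneCurve ht⟩

theorem continuousOn_coneCurve {b : ℝ} (hG : ∀ t ∈ Ioo 0 b, ContinuousAt (fun u => (G u)⁻¹.toEnd) t)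
    (hk : Tendsto (fun t => t ^ (-ζ) • (G t)⁻¹.toEnd k₀) (𝓝[>] 0) (𝓝 v₀)) :
    ContinuousOn (coneCurve ζ G k₀ v₀) (Ico 0 b) := by
  intro t ht
  refine tendsto_subtype_rng.2 ?_
  rcases ht.1.eq_or_lt with rfl | h0
  · rw [← Ioo_insert_left ht.2]
    refine continuousWithinAt_insert_self.2 ?_
    rw [ContinuousWithinAt, coneCurve_zero, nhdsWithin_Ioo_eq_nhdsGT ht.2]
    exact hk.congr' (eventually_mem_nhdsWithin.mono fun u hu => (coe_coneCurve hu).symm)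
  · have hcont : ContinuousAt (fun u => u ^ (-ζ) • (G u)⁻¹.toEnd (k₀ : Mink n)) t :=
      (Real.continuousAt_rpow_const t (-ζ) (.inl h0.ne')).smul
        ((hG t ⟨h0, ht.2⟩).clm_apply continuousAt_const)
    exact (hcont.congr ((eventually_gt_nhds h0).mono fun u hu =>
      (coe_coneCurve hu).symm)).continuousWithinAt

theorem tendsto_smul_coneCurve {φ : ℝ → ℝ} {w : Mink n} {p : ℝ} (hp : 0 < p)
    (h : Tendsto (fun t => φ t • (G t).toEnd) (𝓝[>] 0) (𝓝 (rankOne k₀ w))) (T : Lorentz n) :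
    Tendsto (fun t => (p ^ (-ζ) * φ t) • (T * (G p)⁻¹ * G t).toEnd) (𝓝[>] 0)
      (𝓝 (rankOne (T.actCone (coneCurve ζ G k₀ v₀ p)) w)) := by
  have hlim : p ^ (-ζ) • ((T * (G p)⁻¹).toEnd * rankOne k₀ w) =
      rankOne (T.actCone (coneCurve ζ G k₀ v₀ p)) w := by
    rw [mul_rankOne, smul_rankOne, Lorentz.coe_actCone, coe_coneCurve hp, map_smul]
    rfl
  rw [← hlim]
  refine ((h.const_mul (T * (G p)⁻¹).toEnd).const_smul (p ^ (-ζ))).congr fun t => ?_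
  rw [mul_smul_comm, smul_smul, ← Lorentz.toEnd_mul]

theorem tendsto_projEnd {α : Type*} {l : Filter α} {T : α → Lorentz n} {φ : α → ℝ}
    {v w : LightCone n} (hφ : ∀ᶠ a in l, φ a ≠ 0)
    (h : Tendsto (fun a => φ a • (T a).toEnd) l (𝓝 (rankOne v w))) :
    Tendsto (fun a => (T a).projEnd) l (𝓝 (v.projRankOne w)) :=
  tendsto_mk _ _ hφ h

end ConeCurve

section Cocycle

variable {n : ℕ} {ψ : ℝ → End n} {U : Set ℝ} {p : ℝ}

theorem IsPrimitive.eq_inv_mul {G H : ℝ → Lorentz n} {r t : ℝ} (hG : IsPrimitive ψ U p G)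
    (hH : IsPrimitive ψ U r H) (hU : IsOpen U) (hUc : IsPreconnected U) (hp : p ∈ U) (ht : t ∈ U) :
    G t = (H p)⁻¹ * H t := by
  have h := mul_inv_eq_of_hasDerivAt hU hUc hG.hasDerivAt hH.hasDerivAt hp ht
  rw [hG.init, one_mul] at h
  exact mul_inv_eq_iff_eq_mul.1 h

theorem IsPrimitive.mul_eq_mul {Γ g G : ℝ → Lorentz n} {t : ℝ} (hΓ : IsPrimitive ψ U p Γ)
    (hg : ∀ t ∈ U, DifferentiableAt ℝ (fun τ => (g τ).toEnd) t)
    (hG : IsPrimitive (gauge g ψ) U p G) (hU : IsOpen U) (hUc : IsPreconnected U) (hp : p ∈ U)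
    (ht : t ∈ U) : Γ t * g t = g p * G t := by
  have h := mul_inv_eq_of_hasDerivAt hU hUc
    (fun u hu => hasDerivAt_mul_gauge (hΓ.hasDerivAt u hu) (hg u hu)) hG.hasDerivAt hp ht
  rw [hG.init, hΓ.init, inv_one, one_mul, mul_one] at h
  exact mul_inv_eq_iff_eq_mul.1 h

end Cocycle

end Moebius

end

theorem theorem5p3_general {n : ℕ} {ε b : ℝ} (hε : 0 < ε) (hb : 0 < b)
    {c : ℝ → Moebius.LightCone n} (hc : Moebius.IsRegularLift c (Ioo (-ε) b)) {Q : ℝ → ℝ} {q : ℝ}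
    (hpole : Moebius.HasPole Q 0 b 2 q) {lam : ℝ} (hlam : 0 ≤ 1 - 2 * (lam * q)) :
    (∀ (p : ℝ) (Γ : ℝ → Moebius.Lorentz n),
      Moebius.IsPrimitive (fun t => lam • Moebius.assocForm c Q t) (Ioo 0 b) p Γ →
        ∃ P : Moebius.Sphere n, Tendsto (Moebius.calapso c Γ) (𝓝[>] 0) (𝓝 P)) ∧
    ∀ (B : Moebius.PseudoTriple n) (s : ℝ → ℝ) (F : ℝ → Moebius.Lorentz n)
      (A : ℝ → Moebius.End n), Moebius.IsPolarFrame B c s F A b →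
      ∀ G : ℝ → ℝ → Moebius.Lorentz n,
      (∀ p ∈ Ioo 0 b, Moebius.IsPrimitive
        (Moebius.gauge (Moebius.singularGauge B s F) fun t => lam • Moebius.assocForm c Q t)
        (Ioo 0 b) p (G p)) →
      ∃ k : ℝ → Moebius.LightCone n,
        ContinuousOn k (Ico 0 b) ∧
        (k 0).span = (B.vPlus (lam * q)).span ∧
        (∀ p ∈ Ioo 0 b, ∀ t ∈ Ioo 0 b, (k t).span = (G t p).act (k p).span) ∧
        (∀ p ∈ Ioo 0 b, Tendsto (fun t => (G p t).projEnd) (𝓝[>] 0)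
          (𝓝 ((k p).projRankOne (B.vMinus (lam * q))))) ∧
        ∀ p ∈ Ioo 0 b, ∀ Γ : ℝ → Moebius.Lorentz n,
          Moebius.IsPrimitive (fun t => lam • Moebius.assocForm c Q t) (Ioo 0 b) p Γ →
            Tendsto (Moebius.calapso c Γ) (𝓝[>] 0)
              (𝓝 ((Moebius.singularGauge B s F p).act (k p).span)) := by
  refine ⟨fun p Γ hΓ => Moebius.exists_tendsto_calapso hε hb hc hpole hlam hΓ,
    fun B s F A hF G hG => ?_⟩
  have hp₀ : b / 2 ∈ Ioo 0 b := ⟨half_pos hb, half_lt_self hb⟩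
  have hnear : ∀ᶠ t in 𝓝[>] 0, t ∈ Ioo 0 b := Ioo_mem_nhdsGT hb
  obtain ⟨k₀, hk₀, φ, hφ, hφk⟩ := Moebius.exists_primitive_asymptotics hlam
    (hF.gauge_isBigO hb (hpole.isBigO hb) lam) (hnear.mono (hG _ hp₀).hasDerivAt)
  have hcocycle {p t : ℝ} (hp : p ∈ Ioo 0 b) (ht : t ∈ Ioo 0 b) :
      G p t = (G (b / 2) p)⁻¹ * G (b / 2) t :=
    (hG p hp).eq_inv_mul (hG _ hp₀) isOpen_Ioo isPreconnected_Ioo hp ht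
  set ζ := √(1 - 2 * (lam * q))
  have hφ' {p : ℝ} (hp : p ∈ Ioo 0 b) : ∀ᶠ t in 𝓝[>] 0, p ^ (-ζ) * φ t ≠ 0 :=
    hφ.mono fun t => mul_ne_zero (Real.rpow_pos_of_pos hp.1 _).ne'
  refine ⟨Moebius.coneCurve ζ (G (b / 2)) k₀ (B.vPlus (lam * q)),
    Moebius.continuousOn_coneCurve (fun t ht =>
      (Moebius.Lorentz.hasDerivAt_inv ((hG _ hp₀).hasDerivAt t ht)).continuousAt) hk₀,
    by rw [Moebius.coneCurve_zero], fun p hp t ht => ?_, fun p hp => ?_, fun p hp Γ hΓ => ?_⟩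
  · rw [hcocycle ht hp, Moebius.span_coneCurve ht.1, Moebius.span_coneCurve hp.1,
      ← Moebius.Lorentz.mul_act, mul_inv_cancel_right]
  · refine Moebius.tendsto_projEnd (hφ' hp)
      ((Moebius.tendsto_smul_coneCurve hp.1 hφk 1).congr' <| hnear.mono fun t ht => ?_)
    beta_reduce
    rw [one_mul, hcocycle hp ht]
  · rw [Moebius.Lorentz.act_span]
    refine Moebius.tendsto_calapso (v := B.oL) (by simp [B.coe_oL, B.mink_vMinus_o])
      (hnear.mono fun t => hF.singularGauge_lift) (hφ' hp)
      ((Moebius.tendsto_smul_coneCurve hp.1 hφk (Moebius.singularGauge B s F p)).congr' <|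
        hnear.mono fun t ht => ?_)
    beta_reduce
    rw [hΓ.mul_eq_mul (fun t ht => hF.differentiableAt_singularGauge ht) (hG p hp) isOpen_Ioo
      isPreconnected_Ioo hp ht, hcocycle hp ht, mul_assoc]

theorem theorem5p3 (n : ℕ) (ε b : ℝ) (hε : 0 < ε) (hb : 0 < b)
    (c : ℝ → Moebius.LightCone n) (hc : Moebius.IsRegularLift c (Set.Ioo (-ε) b))
    (Q : ℝ → ℝ) (hQ : ∀ t ∈ Set.Ioo 0 b, Q t ≠ 0)
    (q : ℝ) (hpole : Moebius.HasPole Q 0 b 2 q)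
    (lam : ℝ) (hlam : 0 ≤ 1 - 2 * (lam * q)) :
    (∀ p ∈ Set.Ioo 0 b, ∀ Γ : ℝ → Moebius.Lorentz n,
      Moebius.IsPrimitive (fun t => lam • Moebius.assocForm c Q t) (Set.Ioo 0 b) p Γ →
        ∃ P : Moebius.Sphere n,
          Filter.Tendsto (Moebius.calapso c Γ) (nhdsWithin 0 (Set.Ioi 0)) (nhds P)) ∧
    (∀ δ : ℝ, 0 < δ → δ ≤ ε →
      ∀ s : ℝ → ℝ, Moebius.IsPolarParameter Q q δ b s →
      ∀ (B : Moebius.PseudoTriple n) (F : ℝ → Moebius.Lorentz n),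
      Moebius.IsFrame B c s (Set.Ioo (-δ) b) F →
      ∀ G : ℝ → ℝ → Moebius.Lorentz n,
      (∀ p ∈ Set.Ioo 0 b, Moebius.IsPrimitive
        (Moebius.gauge (Moebius.singularGauge B s F) (fun t => lam • Moebius.assocForm c Q t))
        (Set.Ioo 0 b) p (G p)) →
      ∃ k : ℝ → Moebius.LightCone n,
        ContinuousOn k (Set.Ico 0 b) ∧
        (k 0).span = (B.vPlus (lam * q)).span ∧
        (∀ p ∈ Set.Ioo 0 b, ∀ t ∈ Set.Ioo 0 b, (k t).span = (G t p).act (k p).span) ∧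
        (∀ p ∈ Set.Ioo 0 b, Filter.Tendsto (fun t => (G p t).projEnd)
          (nhdsWithin 0 (Set.Ioi 0)) (nhds ((k p).projRankOne (B.vMinus (lam * q))))) ∧
        (∀ p ∈ Set.Ioo 0 b, ∀ Γ : ℝ → Moebius.Lorentz n,
          Moebius.IsPrimitive (fun t => lam • Moebius.assocForm c Q t) (Set.Ioo 0 b) p Γ →
            Filter.Tendsto (Moebius.calapso c Γ) (nhdsWithin 0 (Set.Ioi 0))
              (nhds ((Moebius.singularGauge B s F p).act (k p).span)))) := by
  have h := theorem5p3_general hε hb hc hpole hlam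
  exact ⟨fun p _ => h.1 p, fun δ hδ hδε s hs B F hF =>
    h.2 B s F _ (hF.isPolarFrame hδ hδε hb hc hs hpole)⟩
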